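/- Let $U\subset\mathbb{C}$ be a domain (a nonempty connected open set) that is regular, i.e. $U=\operatorname{int}(\overline{U})$, and suppose that $\overline{U}$ is a full compact set, i.e. $\overline{U}$ is compact and $\mathbb{C}\setminus\overline{U}$ is connected. Let $(n_j)_{j\ge 1}$ and $(m_j)_{j\ge 1}$ be sequences of non-negative integers with $(m_j)_{j\ge 1}$ strictly increasing, and set $n_0=m_0=0$. Then there are a bounded domain $D\subset\mathbb{C}$ and a transcendental entire function $f$ such that $U$ is a wandering domain of $f$ and, for every integer $n\ge 1$: (i) either $f^n(U)\subset D$ or $f^n(U)\subset\mathbb{C}\setminus\overline{D}$; and (ii) $f^n(U)\subset D$ if and only if there is an integer $p\ge 0$ with $$\sum_{i=0}^{p}(n_i+m_i)<n\le\Big(\sum_{i=0}^{p}(n_i+m_i)\Big)+n_{p+1}.$$ Here $f^n$ is the $n$th iterate of $f$; the Fatou set of $f$ is the set of points having a neighbourhood in which the iterates of $f$ form a normal family (locally uniform convergence to $\infty$ being allowed); and a wandering domain of $f$ is a connected component $U$ of the Fatou set such that $f^k(U)\cap f^l(U)=\emptyset$ whenever $k\ne l$, $k,l\ge 0$. -/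

import Mathlib

open Set Filter Topology

/-- A domain in the complex plane: a nonempty connected open set. -/
def IsPlaneDomain (U : Set ℂ) : Prop :=
  IsOpen U ∧ IsConnected U

/-- A domain is regular if it equals the interior of its closure. -/
def IsRegularDomain (U : Set ℂ) : Prop :=
  IsPlaneDomain U ∧ interior (closure U) = U

/-- A full compact set: a compact set with connected complement. -/
def IsFullCompact (K : Set ℂ) : Prop :=
  IsCompact K ∧ IsConnected Kᶜ

/-- A transcendental entire function: entire and not a polynomial. -/
def IsTranscendentalEntire (f : ℂ → ℂ) : Prop :=
  Differentiable ℂ f ∧ ¬ ∃ p : Polynomial ℂ, ∀ z, f z = p.eval z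

/-- The sequence `g` tends to infinity locally uniformly on `V`. -/
def TendstoInftyLocallyUniformlyOn (g : ℕ → ℂ → ℂ) (V : Set ℂ) : Prop :=
  ∀ K ⊆ V, IsCompact K → ∀ R : ℝ, ∀ᶠ k in atTop, ∀ z ∈ K, R < ‖g k z‖

/-- Normality (in the classical sense, with the constant limit infinity allowed) on a domain `V` of
a family `F` of functions holomorphic in `V`: every sequence in `F` has a subsequence that converges
locally uniformly on `V` either to a finite function or to infinity. -/
def IsNormalFamilyOn (F : Set (ℂ → ℂ)) (V : Set ℂ) : Prop :=
  ∀ g : ℕ → ℂ → ℂ, (∀ k, g k ∈ F) → ∃ φ : ℕ → ℕ, StrictMono φ ∧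
    ((∃ h : ℂ → ℂ, TendstoLocallyUniformlyOn (fun k => g (φ k)) h atTop V) ∨
      TendstoInftyLocallyUniformlyOn (fun k => g (φ k)) V)

/-- The Fatou set of an entire function: the points that have a (connected open) neighbourhood
in which the iterates form a normal family. -/
def fatouSet (f : ℂ → ℂ) : Set ℂ :=
  {z | ∃ V : Set ℂ, IsPlaneDomain V ∧ z ∈ V ∧ IsNormalFamilyOn (range fun n : ℕ => f^[n]) V}

/-- A Fatou component: a connected component of the Fatou set. -/
def IsFatouComponent (f : ℂ → ℂ) (U : Set ℂ) : Prop :=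
  ∃ z ∈ fatouSet f, U = connectedComponentIn (fatouSet f) z

/-- A wandering domain: a Fatou component whose images under distinct iterates are disjoint. -/
def IsWanderingDomain (f : ℂ → ℂ) (U : Set ℂ) : Prop :=
  IsFatouComponent f U ∧ ∀ k l : ℕ, ((f^[k] '' U) ∩ (f^[l] '' U)).Nonempty → k = l

/-! After a translation, `closure U` becomes a compact set `K` near `2ρ`, and `D` becomes the disc
of radius `ρ` about `0`. The function is a limit of entire functions, all close on that disc to
`basePoly z = 1 - (1 - z) ^ 2`, so that points near `1` stay near `1` forever.

Before stage `k` the current map has carried `K` in `N k` steps into a small disc about `c`, outside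
the disc of radius `R k`. The map is then changed near `c`: it contracts the image of `K` to a tiny
set about a chosen point `v`, but sends the image of a point `x k ∉ K`, very close to the frontier
of `K`, into the trap about `1`. The orbit of `v` under the old map performs the prescribed visit to
`D` and an excursion outside, ending beyond everything built so far. A second change prolongs by one
step an auxiliary orbit leaving `D` from `q`; this provides the longer excursions needed later.

In the limit, the diameters of the iterates of `K` tend to `0`, so `U` lies in the Fatou set. Points
of `U` escape along the times `N k`, whereas each `x k` is trapped; since the `x k` accumulate at
every frontier point, no frontier point is in the Fatou set, and `U` is a component. The images of
`U` are disjoint because at infinitely many times they lie outside a disc and then spend arbitrarily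
many consecutive steps inside it.

Two tools replace general approximation theory. `IsGlueDisc.exists_approx` interpolates two entire
functions on two discs by an explicit cutoff. `Follows.exists_separating` separates the image of `K`
from the image of `x k`: the maps stay nearly affine along the orbit of `K`, hence have approximate
entire inverses, through which a separating function for `K` and `x k` is transported. -/

/-! ### Separation of points from full compact sets. -/

/-- On a full compact set, every outside point can be separated from the set by an entire function. -/
theorem IsFullCompact.exists_separating {K : Set ℂ} (hK : IsFullCompact K) {x : ℂ} (hx : x ∉ K) :
    ∃ r : ℂ → ℂ, Differentiable ℂ r ∧ (∀ z ∈ K, ‖r z‖ < 1 / 4) ∧ r x = 1 := by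
  obtain ⟨hc, hconn⟩ := hK
  have : CompactSpace K := isCompact_iff_compactSpace.mp hc
  let X : C(K, ℂ) := ⟨fun z => (z : ℂ), continuous_subtype_val⟩
  let S : Subalgebra ℂ C(K, ℂ) := (Algebra.adjoin ℂ {X}).topologicalClosure
  have hXS : X ∈ S := Subalgebra.le_topologicalClosure _ (Algebra.subset_adjoin rfl)
  let Y : S := ⟨X, hXS⟩
  have : IsClosed (S : Set C(K, ℂ)) := Subalgebra.isClosed_topologicalClosure _
  have hspec : spectrum ℂ X = K := by
    rw [ContinuousMap.spectrum_eq_range]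
    ext z; simp [X]
  -- Passing to a closed subalgebra can only fill holes of the spectrum, and `K` has none. Hence `1
  -- / (x - z)` is a uniform limit on `K` of polynomials; `q` is one of them.
  have h1 : spectrum ℂ Y = spectrum ℂ X :=
    Subalgebra.spectrum_eq_of_isPreconnected_compl S Y
      (by change IsPreconnected (spectrum ℂ X)ᶜ; rw [hspec]; exact hconn.2)
  have h2 : x ∉ spectrum ℂ Y := by rw [h1, hspec]; exact hx
  rw [spectrum.notMem_iff] at h2
  obtain ⟨v, hv⟩ := h2.exists_right_inv
  have hvS : (v : C(K, ℂ)) ∈ closure ((Algebra.adjoin ℂ {X} : Subalgebra ℂ C(K, ℂ)) : Set C(K, ℂ)) :=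
    v.2
  obtain ⟨B, hB0, hB⟩ : ∃ B : ℝ, 0 < B ∧ ∀ z ∈ K, ‖x - z‖ < B := by
    obtain ⟨B, hB⟩ := (hc.image (f := fun z => ‖x - z‖) (by fun_prop)).bddAbove
    exact ⟨max B 0 + 1, by positivity, fun z hz =>
      lt_of_le_of_lt (hB (mem_image_of_mem _ hz)) (by linarith [le_max_left B 0])⟩
  obtain ⟨g, hg, hgv⟩ := Metric.mem_closure_iff.mp hvS (1 / (4 * B)) (by positivity)
  have hpoly : ∃ q : ℂ → ℂ, Differentiable ℂ q ∧ ∀ z : K, g z = q z := by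
    clear hgv
    induction hg using Algebra.adjoin_induction with
    | mem y hy =>
      rw [mem_singleton_iff] at hy
      subst hy
      exact ⟨id, differentiable_id, fun z => rfl⟩
    | algebraMap r => exact ⟨fun _ => r, by fun_prop, fun z => rfl⟩
    | add a b _ _ ha hb =>
      obtain ⟨p, hp, hp'⟩ := ha
      obtain ⟨q, hq, hq'⟩ := hb
      exact ⟨fun z => p z + q z, by fun_prop, fun z => by simp [hp', hq']⟩
    | mul a b _ _ ha hb =>
      obtain ⟨p, hp, hp'⟩ := ha
      obtain ⟨q, hq, hq'⟩ := hb
      exact ⟨fun z => p z * q z, by fun_prop, fun z => by simp [hp', hq']⟩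
  obtain ⟨q, hq, hq'⟩ := hpoly
  refine ⟨fun z => 1 - (x - z) * q z, by fun_prop, fun z hz => ?_, by simp⟩
  have e1 : (x - z) * v.1 ⟨z, hz⟩ = 1 := by
    have := congrArg (fun s : S => (s : C(K, ℂ)) ⟨z, hz⟩) hv
    simpa [Y, X, Algebra.algebraMap_eq_smul_one] using this
  have e2 : ‖v.1 ⟨z, hz⟩ - q z‖ < 1 / (4 * B) := by
    rw [← hq' ⟨z, hz⟩, ← dist_eq_norm]
    exact lt_of_le_of_lt (ContinuousMap.dist_apply_le_dist _) hgv
  have e3 : 1 - (x - z) * q z = (x - z) * (v.1 ⟨z, hz⟩ - q z) := by rw [mul_sub, e1]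
  change ‖1 - (x - z) * q z‖ < 1 / 4
  rw [e3, norm_mul]
  calc ‖x - z‖ * ‖v.1 ⟨z, hz⟩ - q z‖ ≤ ‖x - z‖ * (1 / (4 * B)) := by gcongr
    _ < B * (1 / (4 * B)) := by gcongr; exact hB z hz
    _ = 1 / 4 := by field_simp

/-! ### Gluing two entire functions. -/

/-- The cubic smooth step, with superattracting fixed points `0` and `1`. -/
def smoothStep (t : ℂ) : ℂ := 3 * t ^ 2 - 2 * t ^ 3

theorem differentiable_smoothStep_iterate (n : ℕ) : Differentiable ℂ smoothStep^[n] := by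
  apply Differentiable.iterate
  unfold smoothStep
  fun_prop

theorem norm_smoothStep_iterate_le {t : ℂ} (ht : ‖t‖ ≤ 1 / 4) (n : ℕ) :
    ‖smoothStep^[n] t‖ ≤ (7 / 8) ^ n * (1 / 4) := by
  induction n with
  | zero => simpa using ht
  | succ n ih =>
    rw [Function.iterate_succ_apply']
    set s := smoothStep^[n] t
    have hs : ‖s‖ ≤ 1 / 4 := ih.trans (by
      have : (7 / 8 : ℝ) ^ n ≤ 1 := pow_le_one₀ (by norm_num) (by norm_num)
      linarith)
    have : smoothStep s = s * (s * (3 - 2 * s)) := by unfold smoothStep; ring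
    have h3 : ‖3 - 2 * s‖ ≤ 7 / 2 := by
      calc ‖3 - 2 * s‖ ≤ ‖(3 : ℂ)‖ + ‖2 * s‖ := norm_sub_le _ _
        _ ≤ 7 / 2 := by rw [norm_mul]; norm_num; linarith
    rw [this, norm_mul, norm_mul]
    calc ‖s‖ * (‖s‖ * ‖3 - 2 * s‖) ≤ ((7 / 8) ^ n * (1 / 4)) * ((1 / 4) * (7 / 2)) := by gcongr
      _ = _ := by ring

/-- This symmetry transfers the contraction estimate at `0` to the fixed point `1`. -/
theorem smoothStep_iterate_one_sub (t : ℂ) (n : ℕ) :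
    smoothStep^[n] (1 - t) = 1 - smoothStep^[n] t := by
  induction n with
  | zero => rfl
  | succ n ih =>
    rw [Function.iterate_succ_apply', Function.iterate_succ_apply', ih]
    unfold smoothStep; ring

/-- The disc of centre `c` and radius `r` is small enough, relative to `R < ‖c‖`, that a power
of `z / c` maps it close to `1` and the disc of radius `R` close to `0`. -/
def IsGlueDisc (R : ℝ) (c : ℂ) (r : ℝ) : Prop :=
  0 < r ∧ c ≠ 0 ∧ R + r < ‖c‖ ∧ ∃ m : ℕ, (∀ z, ‖z‖ ≤ R → ‖(z / c) ^ m‖ ≤ 1 / 4) ∧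
    ∀ z ∈ Metric.closedBall c r, ‖(z / c) ^ m - 1‖ ≤ 1 / 4

theorem IsGlueDisc.mono {R r r' : ℝ} {c : ℂ} (h : IsGlueDisc R c r) (h0 : 0 < r') (h1 : r' ≤ r) :
    IsGlueDisc R c r' := by
  obtain ⟨_, hc, hR, m, h2, h3⟩ := h
  exact ⟨h0, hc, by linarith, m, h2, fun z hz => h3 z (Metric.closedBall_subset_closedBall h1 hz)⟩

theorem exists_isGlueDisc {R : ℝ} {c : ℂ} (hR : 0 < R) (hc : R < ‖c‖) :
    ∃ r, IsGlueDisc R c r := by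
  have hc0 : 0 < ‖c‖ := hR.trans hc
  have hne : c ≠ 0 := norm_pos_iff.mp hc0
  obtain ⟨m, hm⟩ := exists_pow_lt_of_lt_one (show (0 : ℝ) < 1 / 4 by norm_num)
    ((div_lt_one hc0).mpr hc)
  have hcont : ContinuousAt (fun z : ℂ => ‖(z / c) ^ m - 1‖) c := by fun_prop
  have hev : ∀ᶠ z in 𝓝 c, ‖(z / c) ^ m - 1‖ < 1 / 4 :=
    hcont.eventually_lt_const (by simp [div_self hne])
  obtain ⟨s, hs, hs'⟩ := Metric.eventually_nhds_iff.mp hev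
  have h1 : min (s / 2) ((‖c‖ - R) / 2) < s := by
    linarith [min_le_left (s / 2) ((‖c‖ - R) / 2)]
  have h2 := min_le_right (s / 2) ((‖c‖ - R) / 2)
  refine ⟨min (s / 2) ((‖c‖ - R) / 2), ?_, hne, by linarith, m, fun z hz => ?_, fun z hz => ?_⟩
  · have : 0 < ‖c‖ - R := by linarith
    positivity
  · rw [norm_pow, norm_div]
    refine le_trans ?_ hm.le
    gcongr
  · exact (hs' (lt_of_le_of_lt (Metric.mem_closedBall.mp hz) h1)).le

/-- Simultaneous approximation of two entire functions on a disc about `0` and a glue disc. -/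
theorem IsGlueDisc.exists_approx {R r : ℝ} {c : ℂ} (h : IsGlueDisc R c r) {f g : ℂ → ℂ}
    (hf : Differentiable ℂ f) (hg : Differentiable ℂ g) {ε : ℝ} (hε : 0 < ε) :
    ∃ F : ℂ → ℂ, Differentiable ℂ F ∧ (∀ z, ‖z‖ ≤ R → ‖F z - f z‖ ≤ ε) ∧
      ∀ z ∈ Metric.closedBall c r, ‖F z - g z‖ ≤ ε := by
  obtain ⟨hr, hc, hRr, m, h1, h2⟩ := h
  have hbd : ∀ C : Set ℂ, IsCompact C → ∃ B : ℝ, 0 < B ∧ ∀ z ∈ C, ‖f z - g z‖ ≤ B := by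
    intro C hC
    obtain ⟨B, hB⟩ := hC.exists_bound_of_continuousOn (f := fun z => f z - g z)
      (hf.continuous.sub hg.continuous).continuousOn
    exact ⟨max B 1, by positivity, fun z hz => (hB z hz).trans (le_max_left _ _)⟩
  obtain ⟨B, hB0, hB⟩ := hbd (Metric.closedBall 0 R ∪ Metric.closedBall c r)
    ((isCompact_closedBall _ _).union (isCompact_closedBall _ _))
  obtain ⟨n, hn⟩ := exists_pow_lt_of_lt_one (show 0 < ε / B by positivity)
    (show (7 / 8 : ℝ) < 1 by norm_num)
  have hn' : (7 / 8 : ℝ) ^ n * (1 / 4) * B ≤ ε := by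
    rw [lt_div_iff₀ hB0] at hn
    have : (0 : ℝ) ≤ (7 / 8) ^ n * B := by positivity
    linarith
  have hχ : Differentiable ℂ fun z => smoothStep^[n] ((z / c) ^ m) :=
    (differentiable_smoothStep_iterate n).comp (by fun_prop)
  -- The iterated smooth step of `(z / c) ^ m` is an entire cutoff: nearly `0` on the disc about the
  -- origin and nearly `1` on the glue disc.
  refine ⟨fun z => f z + smoothStep^[n] ((z / c) ^ m) * (g z - f z),
    hf.add (hχ.mul (hg.sub hf)), fun z hz => ?_, fun z hz => ?_⟩
  · rw [add_sub_cancel_left, norm_mul, norm_sub_rev (g z)]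
    refine le_trans ?_ hn'
    gcongr
    · exact norm_smoothStep_iterate_le (h1 z hz) n
    · exact hB z (Or.inl (by simpa using hz))
  · have e : f z + smoothStep^[n] ((z / c) ^ m) * (g z - f z) - g z =
        (1 - smoothStep^[n] ((z / c) ^ m)) * (f z - g z) := by ring
    rw [e, ← smoothStep_iterate_one_sub, norm_mul]
    refine le_trans ?_ hn'
    gcongr
    · exact norm_smoothStep_iterate_le (by rw [norm_sub_rev]; exact h2 z hz) n
    · exact hB z (Or.inr hz)

/-! ### Stability of finite orbits under perturbation of the map. -/

/-- Iterates depend continuously on the map, as long as the orbit stays in the disc where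
the maps are close to each other. -/
theorem exists_iterate_close {f : ℂ → ℂ} (hf : Continuous f) {C : Set ℂ} (hC : IsCompact C) {R : ℝ}
    {N : ℕ} (h : ∀ i < N, ∀ z ∈ C, ‖f^[i] z‖ < R) {ε : ℝ} (hε : 0 < ε) :
    ∃ η > 0, ∀ g : ℂ → ℂ, (∀ z, ‖z‖ ≤ R → ‖g z - f z‖ ≤ η) →
      ∀ i ≤ N, ∀ z ∈ C, ‖g^[i] z - f^[i] z‖ < ε := by
  induction N generalizing ε with
  | zero =>
    refine ⟨1, one_pos, fun g _ i hi z _ => ?_⟩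
    obtain rfl : i = 0 := by omega
    simpa using hε
  | succ N ih =>
    have hcomp : IsCompact (f^[N] '' C) := hC.image (hf.iterate N)
    -- The margin `d` keeps the perturbed point in the disc where `g` is known to be close to `f`.
    obtain ⟨d, hd, hdR⟩ := hcomp.exists_thickening_subset_open (t := Metric.ball (0 : ℂ) R)
      Metric.isOpen_ball (by
        rintro _ ⟨z, hz, rfl⟩
        simpa using h N (by omega) z hz)
    have huc := (isCompact_closedBall (0 : ℂ) R).uniformContinuousOn_of_continuous hf.continuousOn
    obtain ⟨δ, hδ, hδ'⟩ := Metric.uniformContinuousOn_iff.mp huc (ε / 2) (by positivity)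
    obtain ⟨η, hη, hη'⟩ := ih (fun i hi => h i (by omega))
      (ε := min ε (min d δ)) (by positivity)
    refine ⟨min η (ε / 2), by positivity, fun g hg i hi z hz => ?_⟩
    have hN := hη' g (fun z hz => (hg z hz).trans (min_le_left _ _))
    rcases Nat.lt_or_ge N i with hi' | hi'
    · obtain rfl : i = N + 1 := by omega
      have h1 := hN N le_rfl z hz
      have hmem : g^[N] z ∈ Metric.ball (0 : ℂ) R := by
        apply hdR
        rw [Metric.mem_thickening_iff]
        refine ⟨_, mem_image_of_mem _ hz, ?_⟩
        rw [dist_eq_norm]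
        exact h1.trans_le ((min_le_right _ _).trans (min_le_left _ _))
      have hfm : f^[N] z ∈ Metric.closedBall (0 : ℂ) R := by
        simpa using (h N (by omega) z hz).le
      have h2 := hδ' _ (Metric.ball_subset_closedBall hmem) _ hfm (by
        rw [dist_eq_norm]
        exact h1.trans_le ((min_le_right _ _).trans (min_le_right _ _)))
      have h3 := hg (g^[N] z) (by simpa using (Metric.ball_subset_closedBall hmem))
      rw [Function.iterate_succ_apply', Function.iterate_succ_apply']
      rw [dist_eq_norm] at h2
      calc ‖g (g^[N] z) - f (f^[N] z)‖
          ≤ ‖g (g^[N] z) - f (g^[N] z)‖ + ‖f (g^[N] z) - f (f^[N] z)‖ :=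
            norm_sub_le_norm_sub_add_norm_sub _ _ _
        _ < ε := by linarith [min_le_right η (ε / 2)]
    · exact (hN i hi' z hz).trans_le (min_le_left _ _)

theorem exists_iterate_mem {f : ℂ → ℂ} (hf : Continuous f) {C : Set ℂ} (hC : IsCompact C) {R : ℝ}
    {N : ℕ} (h : ∀ i < N, ∀ z ∈ C, ‖f^[i] z‖ < R) {O : ℕ → Set ℂ} (hO : ∀ i ≤ N, IsOpen (O i))
    (hfO : ∀ i ≤ N, ∀ z ∈ C, f^[i] z ∈ O i) :
    ∃ η > 0, ∀ g : ℂ → ℂ, (∀ z, ‖z‖ ≤ R → ‖g z - f z‖ ≤ η) →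
      ∀ i ≤ N, ∀ z ∈ C, g^[i] z ∈ O i := by
  have hex : ∀ i ∈ Iic N, ∀ᶠ ε in 𝓝[>] (0 : ℝ), Metric.thickening ε (f^[i] '' C) ⊆ O i := by
    intro i hi
    obtain ⟨ε, hε, hεO⟩ := (hC.image (hf.iterate i)).exists_thickening_subset_open (hO i hi)
      (by rintro _ ⟨z, hz, rfl⟩; exact hfO i hi z hz)
    filter_upwards [Ioo_mem_nhdsGT hε] with e he
    exact (Metric.thickening_mono he.2.le _).trans hεO
  have hall := (eventually_all_finite (finite_Iic N)).mpr hex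
  obtain ⟨ε, hε, hε0⟩ := (hall.and self_mem_nhdsWithin).exists
  obtain ⟨η, hη, hη'⟩ := exists_iterate_close hf hC h (mem_Ioi.mp hε0)
  refine ⟨η, hη, fun g hg i hi z hz => hε i hi ?_⟩
  rw [Metric.mem_thickening_iff]
  exact ⟨_, mem_image_of_mem _ hz, by rw [dist_eq_norm]; exact hη' g hg i hi z hz⟩

/-! ### Approximate entire left inverses. -/

/-- `f` is uniformly close to an affine isomorphism on a uniform neighbourhood of `Ω`. -/
def NearAffineOn (f : ℂ → ℂ) (Ω : Set ℂ) : Prop :=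
  ∃ a b : ℂ, ∃ d : ℝ, a ≠ 0 ∧ 0 < d ∧
    ∀ w ∈ Ω, ∀ w' ∈ Metric.ball w (2 * d), ‖f w' - (a * w' + b)‖ ≤ ‖a‖ * d / 4

/-- The identity on `Y` is a uniform limit of entire functions of `f`. -/
def ApproxInvertibleOn (f : ℂ → ℂ) (Y : Set ℂ) : Prop :=
  ∀ ε > 0, ∃ G : ℂ → ℂ, Differentiable ℂ G ∧ ∀ w ∈ Y, ‖G (f w) - w‖ < ε

/-- By Cauchy's estimate the deviation `e` of `f` from the affine map is Lipschitz with constant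
`‖a‖ / 4`. Newton's iteration with the fixed slope `a` therefore divides the error by `4` at each
step, and it preserves entire functions. -/
theorem NearAffineOn.approxInvertibleOn {f : ℂ → ℂ} {Ω : Set ℂ} (h : NearAffineOn f Ω)
    (hf : Differentiable ℂ f) : ApproxInvertibleOn f Ω := by
  obtain ⟨a, b, d, ha, hd, h⟩ := h
  have ha' : 0 < ‖a‖ := norm_pos_iff.mpr ha
  let e : ℂ → ℂ := fun w => f w - (a * w + b)
  have he : Differentiable ℂ e := by fun_prop
  have hlip : ∀ w ∈ Ω, ∀ w' ∈ Metric.ball w d, ‖e w - e w'‖ ≤ ‖a‖ / 4 * ‖w - w'‖ := by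
    intro w hw w' hw'
    refine Convex.norm_image_sub_le_of_norm_deriv_le (s := Metric.ball w d) (fun x _ => he x)
      (fun x hx => ?_) (convex_ball w d) hw' (Metric.mem_ball_self hd)
    have := Complex.norm_deriv_le_of_forall_mem_sphere_norm_le (f := e) (c := x) (R := d)
      (C := ‖a‖ * d / 4) hd he.diffContOnCl (fun y hy => h w hw y (by
        rw [mem_sphere_iff_norm] at hy
        rw [mem_ball_iff_norm] at hx ⊢
        calc ‖y - w‖ ≤ ‖y - x‖ + ‖x - w‖ := norm_sub_le_norm_sub_add_norm_sub _ _ _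
          _ < 2 * d := by linarith))
    calc ‖deriv e x‖ ≤ ‖a‖ * d / 4 / d := this
      _ = ‖a‖ / 4 := by field_simp
  have key : ∀ n : ℕ, ∃ G : ℂ → ℂ, Differentiable ℂ G ∧
      ∀ w ∈ Ω, ‖G (f w) - w‖ ≤ (1 / 4) ^ n * (d / 4) := by
    intro n
    induction n with
    | zero =>
      refine ⟨fun y => (y - b) / a, by fun_prop, fun w hw => ?_⟩
      have : (f w - b) / a - w = e w / a := by simp only [e]; field_simp; ring
      rw [this, norm_div, pow_zero, one_mul, div_le_iff₀ ha']
      exact (h w hw w (Metric.mem_ball_self (by positivity))).trans_eq (by ring)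
    | succ n ih =>
      obtain ⟨G, hG, hG'⟩ := ih
      refine ⟨fun y => G y + (y - f (G y)) / a, by fun_prop, fun w hw => ?_⟩
      have hmem : G (f w) ∈ Metric.ball w d := by
        rw [mem_ball_iff_norm]
        refine (hG' w hw).trans_lt ?_
        have : (1 / 4 : ℝ) ^ n ≤ 1 := pow_le_one₀ (by norm_num) (by norm_num)
        nlinarith
      have : G (f w) + (f w - f (G (f w))) / a - w = (e w - e (G (f w))) / a := by
        simp only [e]; field_simp; ring
      rw [this, norm_div, div_le_iff₀ ha']
      calc ‖e w - e (G (f w))‖ ≤ ‖a‖ / 4 * ‖w - G (f w)‖ := hlip w hw _ hmem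
        _ ≤ ‖a‖ / 4 * ((1 / 4) ^ n * (d / 4)) := by
          gcongr
          rw [norm_sub_rev]
          exact hG' w hw
        _ = _ := by ring
  intro ε hε
  obtain ⟨n, hn⟩ := exists_pow_lt_of_lt_one (show 0 < ε / (d / 4) by positivity)
    (show (1 / 4 : ℝ) < 1 by norm_num)
  rw [lt_div_iff₀ (by positivity)] at hn
  obtain ⟨G, hG, hG'⟩ := key n
  exact ⟨G, hG, fun w hw => (hG' w hw).trans_lt hn⟩

theorem ApproxInvertibleOn.comp {f g : ℂ → ℂ} {Y : Set ℂ} (hY : IsCompact Y) (hg : Continuous g)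
    (hgY : ApproxInvertibleOn g Y) (hfY : ApproxInvertibleOn f (g '' Y)) :
    ApproxInvertibleOn (f ∘ g) Y := by
  intro ε hε
  obtain ⟨G, hG, hG'⟩ := hgY (ε / 2) (by positivity)
  have hcomp : IsCompact (Metric.cthickening 1 (g '' Y)) := (hY.image hg).cthickening
  obtain ⟨δ, hδ, hδ'⟩ := Metric.uniformContinuousOn_iff.mp
    (hcomp.uniformContinuousOn_of_continuous hG.continuous.continuousOn) (ε / 2) (by positivity)
  obtain ⟨H, hH, hH'⟩ := hfY (min δ 1) (by positivity)
  refine ⟨G ∘ H, hG.comp hH, fun w hw => ?_⟩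
  have h1 := hH' (g w) (mem_image_of_mem _ hw)
  have h2 : dist (G (H (f (g w)))) (G (g w)) < ε / 2 := by
    refine hδ' _ ?_ _ (Metric.self_subset_cthickening _ (mem_image_of_mem _ hw)) ?_
    · apply Metric.mem_cthickening_of_dist_le _ (g w) _ _ (mem_image_of_mem _ hw)
      rw [dist_eq_norm]
      exact (h1.trans_le (min_le_right _ _)).le
    · rw [dist_eq_norm]
      exact h1.trans_le (min_le_left _ _)
  rw [dist_eq_norm] at h2
  calc ‖G (H (f (g w))) - w‖ ≤ ‖G (H (f (g w))) - G (g w)‖ + ‖G (g w) - w‖ :=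
        norm_sub_le_norm_sub_add_norm_sub _ _ _
    _ < ε := by linarith [hG' w hw]

theorem approxInvertibleOn_iterate {f : ℂ → ℂ} (hf : Differentiable ℂ f) {Y : Set ℂ}
    (hY : IsCompact Y) {N : ℕ} (h : ∀ i < N, NearAffineOn f (f^[i] '' Y)) :
    ApproxInvertibleOn f^[N] Y := by
  induction N with
  | zero => exact fun ε hε => ⟨id, differentiable_id, fun w _ => by simpa using hε⟩
  | succ N ih =>
    rw [Function.iterate_succ']
    exact ApproxInvertibleOn.comp hY (hf.continuous.iterate N) (ih fun i hi => h i (by omega))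
      ((h N (by omega)).approxInvertibleOn hf)

theorem NearAffineOn.mono {f : ℂ → ℂ} {Ω Ω' : Set ℂ} (h : NearAffineOn f Ω) (hs : Ω' ⊆ Ω) :
    NearAffineOn f Ω' := by
  obtain ⟨a, b, d, ha, hd, h⟩ := h
  exact ⟨a, b, d, ha, hd, fun w hw => h w (hs hw)⟩

/-- Maps close to `f` are nearly affine near a noncritical point of `f`. -/
theorem exists_nearAffineOn_ball {f : ℂ → ℂ} (hf : Differentiable ℂ f) {p : ℂ} (hp : deriv f p ≠ 0)
    {r : ℝ} (hr : 0 < r) :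
    ∃ s > 0, ∃ τ > 0, ∀ g : ℂ → ℂ, (∀ z ∈ Metric.ball p r, ‖g z - f z‖ ≤ τ) →
      NearAffineOn g (Metric.ball p s) := by
  have ha : 0 < ‖deriv f p‖ := norm_pos_iff.mpr hp
  have hd := (hf p).hasDerivAt
  rw [hasDerivAt_iff_isLittleO] at hd
  have hev := hd.def (show 0 < ‖deriv f p‖ / 24 by positivity)
  obtain ⟨t, ht, ht'⟩ := Metric.eventually_nhds_iff.mp hev
  set d : ℝ := min t r / 3 with hddef
  have hd0 : 0 < d := by positivity
  have h3t : 3 * d ≤ t := by rw [hddef]; linarith [min_le_left t r]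
  have h3r : 3 * d ≤ r := by rw [hddef]; linarith [min_le_right t r]
  -- The allowed error `‖a‖ * d / 4` is shared equally between the perturbation and the
  -- linearization of `f` on the ball of radius `3 * d`.
  refine ⟨d, hd0, ‖deriv f p‖ * d / 8, by positivity, fun g hg =>
    ⟨deriv f p, f p - deriv f p * p, d, hp, hd0, fun w hw w' hw' => ?_⟩⟩
  have hdist : ‖w' - p‖ < 3 * d := by
    rw [mem_ball_iff_norm] at hw hw'
    calc ‖w' - p‖ ≤ ‖w' - w‖ + ‖w - p‖ := norm_sub_le_norm_sub_add_norm_sub _ _ _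
      _ < 3 * d := by linarith
  have h1 : ‖f w' - f p - (w' - p) • deriv f p‖ ≤ ‖deriv f p‖ / 24 * ‖w' - p‖ :=
    ht' (by rw [dist_eq_norm]; linarith)
  have h2 : ‖g w' - f w'‖ ≤ ‖deriv f p‖ * d / 8 :=
    hg w' (by rw [mem_ball_iff_norm]; linarith)
  have e : g w' - (deriv f p * w' + (f p - deriv f p * p)) =
      (g w' - f w') + (f w' - f p - (w' - p) • deriv f p) := by rw [smul_eq_mul]; ring
  rw [e]
  calc _ ≤ ‖g w' - f w'‖ + ‖f w' - f p - (w' - p) • deriv f p‖ := norm_add_le _ _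
    _ ≤ ‖deriv f p‖ * d / 8 + ‖deriv f p‖ / 24 * (3 * d) := by
      refine add_le_add h2 (h1.trans ?_)
      gcongr
    _ = _ := by ring

/-! ### Orbit segments of maps close to the base polynomial. -/

/-- The quadratic polynomial `2z - z ^ 2`, with a superattracting fixed point at `1`. -/
def basePoly (z : ℂ) : ℂ := 2 * z - z ^ 2

/-- Number of further steps after the first one made at stage `k`: for `some n` the orbit makes
`n` steps in the central disc and then `k + 1` steps outside; for `none` it makes a single step
outside. -/
def stageLength (k : ℕ) : Option ℕ → ℕ
  | some n => n + k
  | none => 0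

/-- The prescribed region for the `j`th point (counted from `0`) of the orbit segment. -/
def stageRegion (ρ : ℝ) (σ : Option ℕ) (j : ℕ) : Set ℂ :=
  {z | if ∃ n, σ = some n ∧ j < n then ‖z‖ < ρ else ρ < ‖z‖}

theorem isOpen_stageRegion (ρ : ℝ) (σ : Option ℕ) (j : ℕ) : IsOpen (stageRegion ρ σ j) := by
  unfold stageRegion
  split_ifs
  · exact isOpen_lt continuous_norm continuous_const
  · exact isOpen_lt continuous_const continuous_norm

section NearBase

variable {f : ℂ → ℂ} {ρ : ℝ}

theorem isOpenMap_of_near_basePoly (hf : Differentiable ℂ f) (hρ : 10 ≤ ρ)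
    (hn : ∀ z, ‖z‖ ≤ ρ → ‖f z - basePoly z‖ ≤ 1 / 10) : IsOpenMap f := by
  have han : AnalyticOnNhd ℂ f univ := hf.differentiableOn.analyticOnNhd isOpen_univ
  rcases han.is_constant_or_isOpenMap with ⟨w, hw⟩ | h
  · exfalso
    have h0 := hn 0 (by simp; linarith)
    have h1 := hn 1 (by simp; linarith)
    simp only [hw, basePoly] at h0 h1
    norm_num at h0 h1
    have : ‖(1 : ℂ)‖ ≤ ‖w‖ + ‖w - 1‖ := by
      calc ‖(1 : ℂ)‖ = ‖w - (w - 1)‖ := by ring_nf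
        _ ≤ _ := norm_sub_le _ _
    norm_num at this
    linarith
  · exact h

/-- On the circle of radius `ρ` the map has modulus about `ρ ^ 2`, while `f 0` is near `0`. The
quantitative open mapping theorem makes the image of the disc cover the disc itself, and no preimage
can lie on the circle. -/
theorem exists_preimage_of_near_basePoly (hf : Differentiable ℂ f) (hρ : 10 ≤ ρ)
    (hn : ∀ z, ‖z‖ ≤ ρ → ‖f z - basePoly z‖ ≤ 1 / 10) {w : ℂ} (hw : ‖w‖ < ρ) :
    ∃ z, ‖z‖ < ρ ∧ f z = w := by
  have hρ0 : 0 < ρ := by linarith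
  have h0 : ‖f 0‖ ≤ 1 / 10 := by simpa [basePoly] using hn 0 (by simp; linarith)
  have hs : ∀ z, ‖z‖ = ρ → ρ ^ 2 - 2 * ρ - 1 / 10 ≤ ‖f z‖ := by
    intro z hz
    have h1 := hn z hz.le
    have h2 : ‖z ^ 2‖ ≤ ‖2 * z‖ + ‖f z - basePoly z‖ + ‖f z‖ := by
      have : z ^ 2 = (2 * z + (f z - basePoly z)) - f z := by unfold basePoly; ring
      rw [this]
      exact (norm_sub_le _ _).trans (by gcongr; exact norm_add_le _ _)
    rw [norm_pow, norm_mul, hz] at h2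
    norm_num at h2
    linarith
  have hopen := isOpenMap_of_near_basePoly hf hρ hn
  have hsub := DiffContOnCl.ball_subset_image_closedBall (f := f) (z₀ := 0) (r := ρ)
    (ε := ρ ^ 2 - 2 * ρ - 2 / 10) hf.diffContOnCl hρ0
    (fun z hz => by
      have := hs z (by simpa using hz)
      have := norm_sub_norm_le (f z) (f 0)
      linarith)
    (by
      by_contra hcon
      rw [not_frequently] at hcon
      obtain ⟨V, hV, hVo, h0V⟩ := mem_nhds_iff.mp hcon
      have hVimg : f '' V = {f 0} := by
        refine (Set.Nonempty.image f ⟨0, h0V⟩).subset_singleton_iff.mp ?_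
        rintro _ ⟨z, hz, rfl⟩
        exact not_not.mp (hV hz)
      have := hopen V hVo
      rw [hVimg] at this
      exact not_isOpen_singleton _ this)
  have hwm : w ∈ Metric.ball (f 0) ((ρ ^ 2 - 2 * ρ - 2 / 10) / 2) := by
    rw [mem_ball_iff_norm]
    have := norm_sub_le w (f 0)
    nlinarith
  obtain ⟨z, hz, hzw⟩ := hsub hwm
  refine ⟨z, lt_of_le_of_ne (by simpa using hz) fun h => ?_, hzw⟩
  have := hs z h
  rw [hzw] at this
  nlinarith

theorem exists_backward_orbit (hf : Differentiable ℂ f) (hρ : 10 ≤ ρ)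
    (hn : ∀ z, ‖z‖ ≤ ρ → ‖f z - basePoly z‖ ≤ 1 / 10) {q : ℂ} (hq : ‖q‖ < ρ) (n : ℕ) :
    ∃ y, f^[n] y = q ∧ ∀ i ≤ n, ‖f^[i] y‖ < ρ := by
  induction n with
  | zero =>
    refine ⟨q, rfl, fun i hi => ?_⟩
    obtain rfl : i = 0 := by omega
    exact hq
  | succ n ih =>
    obtain ⟨y, hy, hi⟩ := ih
    obtain ⟨z, hz, rfl⟩ := exists_preimage_of_near_basePoly hf hρ hn (hi 0 (by omega))
    refine ⟨z, hy, fun i hi' => ?_⟩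
    rcases i with _ | i
    · exact hz
    · exact hi i (by omega)

end NearBase

theorem exists_mem_norm_lt {V : Set ℂ} (hV : IsOpen V) {u : ℂ} (hu : u ∈ V) (h0 : u ≠ 0) :
    ∃ w ∈ V, ‖u‖ < ‖w‖ := by
  have hcont : ContinuousAt (fun t : ℝ => (t : ℂ) * u) 1 := by fun_prop
  have hev : ∀ᶠ t : ℝ in 𝓝 1, (t : ℂ) * u ∈ V :=
    hcont.eventually_mem (hV.mem_nhds (by simpa using hu))
  obtain ⟨t, ht, ht1⟩ := ((hev.filter_mono nhdsWithin_le_nhds).and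
    (self_mem_nhdsWithin : Ioi (1 : ℝ) ∈ 𝓝[>] 1)).exists
  refine ⟨_, ht, ?_⟩
  rw [norm_mul, Complex.norm_real, Real.norm_eq_abs, abs_of_pos (one_pos.trans ht1)]
  have := norm_pos_iff.mpr h0
  have ht1' : 1 < t := ht1
  nlinarith

theorem exists_deriv_ne_zero {f : ℂ → ℂ} (hf : Differentiable ℂ f) (ho : IsOpenMap f) {V : Set ℂ}
    (hV : IsOpen V) (hne : V.Nonempty) : ∃ y ∈ V, deriv f y ≠ 0 := by
  by_contra! hcon
  obtain ⟨x, hx⟩ := hne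
  obtain ⟨r, hr, hrV⟩ := Metric.isOpen_iff.mp hV x hx
  have hconst : ∀ y ∈ Metric.ball x r, f y = f x := fun y hy =>
    Metric.isOpen_ball.is_const_of_deriv_eq_zero (convex_ball x r).isPreconnected
      hf.differentiableOn (fun z hz => hcon z (hrV hz)) hy (Metric.mem_ball_self hr)
  have himg : f '' Metric.ball x r = {f x} := by
    refine (Set.Nonempty.image f ⟨x, Metric.mem_ball_self hr⟩).subset_singleton_iff.mp ?_
    rintro _ ⟨z, hz, rfl⟩
    exact hconst z hz
  have := ho _ (Metric.isOpen_ball (x := x) (ε := r))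
  rw [himg] at this
  exact not_isOpen_singleton _ this

theorem deriv_ne_zero_of_deriv_iterate_ne_zero {f : ℂ → ℂ} (hf : Differentiable ℂ f) {y : ℂ} {T : ℕ}
    (h : deriv f^[T] y ≠ 0) {i : ℕ} (hi : i < T) : deriv f (f^[i] y) ≠ 0 := by
  intro h0
  apply h
  obtain ⟨j, rfl⟩ : ∃ j, T = j + (i + 1) := ⟨T - (i + 1), by omega⟩
  have e : f^[j + (i + 1)] = f^[j] ∘ (f ∘ f^[i]) := by
    rw [Function.iterate_add, Function.iterate_succ']
  rw [e, deriv_comp y ((hf.iterate j) _) ((hf.comp (hf.iterate i)) y),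
    deriv_comp y (hf _) ((hf.iterate i) y), h0]
  ring

theorem IsOpenMap.iterate' {f : ℂ → ℂ} (hf : IsOpenMap f) (n : ℕ) : IsOpenMap f^[n] := by
  induction n with
  | zero => exact IsOpenMap.id
  | succ n ih =>
    rw [Function.iterate_succ]
    exact ih.comp hf

/-- Existence of the orbit segment which the wandering compact set is going to follow. -/
theorem exists_stage_orbit {f : ℂ → ℂ} {ρ R : ℝ} (hf : Differentiable ℂ f) (hρ : 10 ≤ ρ)
    (hn : ∀ z, ‖z‖ ≤ ρ → ‖f z - basePoly z‖ ≤ 1 / 10) (hρR : ρ ≤ R) {k : ℕ} {q : ℂ}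
    (hq : ‖q‖ < ρ) (hq1 : ∀ i, 1 ≤ i → i ≤ k → ρ < ‖f^[i] q‖ ∧ ‖f^[i] q‖ < R)
    (hq2 : R < ‖f^[k + 1] q‖) (σ : Option ℕ) :
    ∃ v, (∀ j < stageLength k σ, ‖f^[j] v‖ < R) ∧ ‖f^[k + 1] q‖ < ‖f^[stageLength k σ] v‖ ∧
      (∀ j < stageLength k σ, deriv f (f^[j] v) ≠ 0) ∧
      ∀ j ≤ stageLength k σ, f^[j] v ∈ stageRegion ρ σ j := by
  rcases σ with _ | n
  -- With no visit to the central disc, any point farther out than the end of the path will do.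
  · refine ⟨((‖f^[k + 1] q‖ + 1 : ℝ) : ℂ), by simp [stageLength], ?_, by simp [stageLength], ?_⟩
    · simp only [stageLength, Function.iterate_zero, id_eq, Complex.norm_real, Real.norm_eq_abs]
      exact (lt_add_one _).trans_le (le_abs_self _)
    · intro j hj
      obtain rfl : j = 0 := by simpa [stageLength] using hj
      simp only [stageRegion, Function.iterate_zero, id_eq, mem_ofPred_eq, Complex.norm_real,
        Real.norm_eq_abs, reduceCtorEq, false_and, exists_false, if_false]
      have := le_abs_self (‖f^[k + 1] q‖ + 1)
      linarith
  · obtain ⟨y₀, hy₀, hy₀'⟩ := exists_backward_orbit hf hρ hn hq n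
    have hiter : ∀ i, f^[n + i] y₀ = f^[i] q := fun i => by
      rw [add_comm, Function.iterate_add_apply, hy₀]
    let Y : Set ℂ := ⋂ i ∈ Iic (n + k), {y | if i ≤ n then ‖f^[i] y‖ < ρ else
      ρ < ‖f^[i] y‖ ∧ ‖f^[i] y‖ < R}
    have hYo : IsOpen Y := by
      refine (finite_Iic (n + k)).isOpen_biInter fun i _ => ?_
      have hc : Continuous fun y => ‖f^[i] y‖ := (hf.continuous.iterate i).norm
      split_ifs
      · exact isOpen_lt hc continuous_const
      · exact (isOpen_lt continuous_const hc).inter (isOpen_lt hc continuous_const)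
    have hy₀Y : y₀ ∈ Y := by
      refine mem_iInter₂.mpr fun i hi => ?_
      have hi' : i ≤ n + k := hi
      rw [mem_ofPred_eq]
      split_ifs with h
      · exact hy₀' i h
      · obtain ⟨j, rfl⟩ : ∃ j, i = n + j := ⟨i - n, by omega⟩
        rw [hiter]
        exact hq1 j (by omega) (by omega)
    have ho : IsOpenMap f^[n + (k + 1)] := (isOpenMap_of_near_basePoly hf hρ hn).iterate' _
    have hdT : Differentiable ℂ f^[n + (k + 1)] := hf.iterate _
    -- All conditions defining `Y` are open, so `y₀` can be moved: the endpoint is pushed strictly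
    -- beyond that of `q`, and a critical orbit is avoided.
    obtain ⟨_, ⟨y₁, hy₁Y, rfl⟩, hy₁⟩ := exists_mem_norm_lt (ho Y hYo) (mem_image_of_mem _ hy₀Y)
      (by rw [hiter, ← norm_pos_iff]; linarith)
    obtain ⟨y, ⟨hyY, hyn⟩, hyd⟩ := exists_deriv_ne_zero hdT ho
      (hYo.inter (isOpen_lt continuous_const hdT.continuous.norm)) ⟨y₁, hy₁Y, hy₁⟩
    rw [mem_ofPred_eq, hiter] at hyn
    have hyY' := mem_iInter₂.mp hyY
    have hs : ∀ j, f^[j] (f y) = f^[j + 1] y := fun j => rfl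
    -- Since `f^[n] y₀ = q` is itself central, the points of index `1, ..., n` of the orbit of `y`
    -- are central and the next `k + 1` are outside. Starting at `f y` gives exactly `n` central
    -- points.
    refine ⟨f y, fun j hj => ?_, ?_, fun j hj => ?_, fun j hj => ?_⟩
    · simp only [stageLength] at hj
      rw [hs]
      have := hyY' (j + 1) (by simp; omega)
      rw [mem_ofPred_eq] at this
      split_ifs at this
      · linarith
      · exact this.2
    · exact hyn
    · simp only [stageLength] at hj
      rw [hs]
      exact deriv_ne_zero_of_deriv_iterate_ne_zero hf hyd (by omega)
    · simp only [stageLength] at hj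
      rw [hs]
      have he : (∃ m, some n = some m ∧ j < m) ↔ j < n := by simp
      rw [stageRegion, mem_ofPred_eq, if_congr he rfl rfl]
      rcases Nat.lt_or_ge j (n + k) with h1 | h1
      · have := hyY' (j + 1) (by simp; omega)
        rw [mem_ofPred_eq] at this
        split_ifs at this ⊢
        · exact this
        · omega
        · omega
        · exact this.1
      · obtain rfl : j = n + k := by omega
        rw [if_neg (by omega)]
        have : f^[n + k + 1] y = f^[n + (k + 1)] y := rfl
        rw [this]
        linarith

/-! ### Moving the compact set along an orbit. -/

/-- `g` is `η`-close to `f` on the closed disc of radius `R` about the origin. -/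
def CloseOn (R η : ℝ) (f g : ℂ → ℂ) : Prop :=
  ∀ z, ‖z‖ ≤ R → ‖g z - f z‖ ≤ η

theorem CloseOn.mono {R R' η η' : ℝ} {f g : ℂ → ℂ} (h : CloseOn R η f g) (hR : R' ≤ R)
    (hη : η ≤ η') : CloseOn R' η' f g :=
  fun z hz => (h z (hz.trans hR)).trans hη

theorem CloseOn.trans {R η η' : ℝ} {f g h : ℂ → ℂ} (hfg : CloseOn R η f g)
    (hgh : CloseOn R η' g h) : CloseOn R (η + η') f h := fun z hz =>
  calc ‖h z - f z‖ ≤ ‖h z - g z‖ + ‖g z - f z‖ := norm_sub_le_norm_sub_add_norm_sub _ _ _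
    _ ≤ η + η' := by linarith [hfg z hz, hgh z hz]

theorem exists_iterate_mem_at {f : ℂ → ℂ} (hf : Continuous f) {C : Set ℂ} (hC : IsCompact C) {R : ℝ}
    {N : ℕ} (h : ∀ i < N, ∀ z ∈ C, ‖f^[i] z‖ < R) {O : Set ℂ} (hO : IsOpen O)
    (hfO : ∀ z ∈ C, f^[N] z ∈ O) :
    ∃ η > 0, ∀ g : ℂ → ℂ, CloseOn R η f g → ∀ z ∈ C, g^[N] z ∈ O := by
  obtain ⟨η, hη, H⟩ := exists_iterate_mem hf hC h (O := fun i => if i = N then O else univ)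
    (fun i _ => by
      split_ifs
      exacts [hO, isOpen_univ])
    (fun i _ z hz => by
      split_ifs with hi
      · subst hi; exact hfO z hz
      · trivial)
  exact ⟨η, hη, fun g hg z hz => by simpa using H g hg N le_rfl z hz⟩

/-- The first `N` images of `K` under `g` stay in the disc of radius `R`, the map being nearly
affine on each of them, and the `N`th one lies in the disc of centre `c` and radius `r`. -/
structure Follows (K : Set ℂ) (R : ℝ) (N : ℕ) (c : ℂ) (r : ℝ) (g : ℂ → ℂ) : Prop where
  norm_lt : ∀ i < N, ∀ z ∈ K, ‖g^[i] z‖ < R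
  nearAffine : ∀ i < N, ∃ Ω, IsOpen Ω ∧ (∀ z ∈ K, g^[i] z ∈ Ω) ∧ NearAffineOn g Ω
  mem_ball : ∀ z ∈ K, g^[N] z ∈ Metric.ball c r

theorem ApproxInvertibleOn.exists_approx {f : ℂ → ℂ} {Y : Set ℂ} (h : ApproxInvertibleOn f Y)
    (hY : IsCompact Y) {p : ℂ → ℂ} (hp : Differentiable ℂ p) {ε : ℝ} (hε : 0 < ε) :
    ∃ P : ℂ → ℂ, Differentiable ℂ P ∧ ∀ z ∈ Y, ‖P (f z) - p z‖ < ε := by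
  obtain ⟨δ, hδ, hδ'⟩ := Metric.uniformContinuousOn_iff.mp
    ((hY.cthickening (r := 1)).uniformContinuousOn_of_continuous hp.continuous.continuousOn) ε hε
  obtain ⟨G, hG, hG'⟩ := h (min δ 1) (by positivity)
  refine ⟨p ∘ G, hp.comp hG, fun z hz => ?_⟩
  have h1 := hG' z hz
  rw [← dist_eq_norm] at h1 ⊢
  exact hδ' _ (Metric.mem_cthickening_of_dist_le _ z _ _ hz (h1.trans_le (min_le_right _ _)).le)
    _ (Metric.self_subset_cthickening _ hz) (h1.trans_le (min_le_left _ _))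

/-- Nearly affine behaviour holds on open sets, so it extends from `K` to some `x ∉ K` near `ζ`.
Then `f^[N]` is approximately invertible on `insert x K`, and the function separating `x` from `K`
can be pushed forward to the images. -/
theorem Follows.exists_separating {K : Set ℂ} (hK : IsFullCompact K) {R r : ℝ} {N : ℕ} {c : ℂ}
    {f : ℂ → ℂ} (hf : Differentiable ℂ f) (hF : Follows K R N c r f) {ζ : ℂ} (hζ : ζ ∈ frontier K)
    {ε : ℝ} (hε : 0 < ε) :
    ∃ x, x ∉ K ∧ dist x ζ < ε ∧ (∀ i < N, ‖f^[i] x‖ < R) ∧ f^[N] x ∈ Metric.ball c r ∧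
      ∃ p : ℂ → ℂ, Differentiable ℂ p ∧ (∀ z ∈ K, ‖p (f^[N] z)‖ < 1 / 2) ∧ p (f^[N] x) = 1 := by
  choose! Ω hΩo hΩK hΩ using hF.nearAffine
  let W : Set ℂ := (⋂ i ∈ Iio N, f^[i] ⁻¹' (Ω i ∩ Metric.ball 0 R)) ∩ f^[N] ⁻¹' Metric.ball c r
  have hWo : IsOpen W := by
    refine ((finite_Iio N).isOpen_biInter fun i hi => ?_).inter ?_
    · exact ((hΩo i hi).inter Metric.isOpen_ball).preimage (hf.continuous.iterate i)
    · exact Metric.isOpen_ball.preimage (hf.continuous.iterate N)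
  have hζK : ζ ∈ K := hK.1.isClosed.frontier_subset hζ
  have hζW : ζ ∈ W := by
    refine ⟨mem_iInter₂.mpr fun i hi => ⟨hΩK i hi ζ hζK, ?_⟩, hF.mem_ball ζ hζK⟩
    simpa using hF.norm_lt i hi ζ hζK
  rw [frontier_eq_closure_inter_closure] at hζ
  obtain ⟨x, ⟨hxW, hxζ⟩, hxK⟩ := mem_closure_iff.mp hζ.2 (W ∩ Metric.ball ζ ε)
    (hWo.inter Metric.isOpen_ball) ⟨hζW, Metric.mem_ball_self hε⟩
  have hxW1 := mem_iInter₂.mp hxW.1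
  refine ⟨x, hxK, hxζ, fun i hi => by simpa using (hxW1 i hi).2, hxW.2, ?_⟩
  obtain ⟨q, hq, hqK, hqx⟩ := hK.exists_separating hxK
  have hY : IsCompact (insert x K) := hK.1.insert x
  have hAI : ApproxInvertibleOn f^[N] (insert x K) := by
    refine approxInvertibleOn_iterate hf hY fun i hi => (hΩ i hi).mono ?_
    rintro _ ⟨z, rfl | hz, rfl⟩
    · exact (hxW1 i hi).1
    · exact hΩK i hi z hz
  obtain ⟨P, hP, hPY⟩ := hAI.exists_approx hY hq (show (0 : ℝ) < 1 / 16 by norm_num)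
  have hβ := hPY x (mem_insert _ _)
  rw [hqx] at hβ
  have hβ' : 15 / 16 < ‖P (f^[N] x)‖ := by
    have := norm_sub_norm_le (1 : ℂ) (P (f^[N] x))
    rw [norm_sub_rev, norm_one] at this
    linarith
  -- After normalization the bound on `K` is `(1/4 + 1/16) / (15/16) = 1/3`.
  refine ⟨fun z => P z / P (f^[N] x), by fun_prop, fun z hz => ?_, ?_⟩
  · have h1 := hPY z (mem_insert_of_mem _ hz)
    have h2 := norm_sub_norm_le (P (f^[N] z)) (q z)
    have h3 := hqK z hz
    dsimp only
    rw [norm_div, div_lt_iff₀ (by linarith)]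
    linarith
  · exact div_self (norm_pos_iff.mp (by linarith))

/-- The local model for the map near the `N`th image of `K`: it shrinks this image to a small disc
about `v`, but maps the image of some point close to `K` into a disc about `1`. -/
theorem Follows.exists_local_model {K : Set ℂ} (hK : IsFullCompact K) {R r : ℝ} {N : ℕ} {c : ℂ}
    {f : ℂ → ℂ} (hf : Differentiable ℂ f) (hF : Follows K R N c r f) (hr : 0 < r) {ζ : ℂ}
    (hζ : ζ ∈ frontier K) {ε : ℝ} (hε : 0 < ε) (v : ℂ) {s : ℝ} (hs : 0 < s) :
    ∃ x, x ∉ K ∧ dist x ζ < ε ∧ ∃ g : ℂ → ℂ, Differentiable ℂ g ∧ ∃ Ω, IsOpen Ω ∧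
      ∃ τ > 0, ∀ h : ℂ → ℂ, CloseOn R τ f h → (∀ z ∈ Metric.closedBall c r, ‖h z - g z‖ ≤ τ) →
        (∀ z ∈ K, h^[N] z ∈ Ω) ∧ NearAffineOn h Ω ∧ (∀ z ∈ K, h^[N + 1] z ∈ Metric.ball v s) ∧
        h^[N] x ∈ Metric.ball c r ∧ ‖h^[N + 1] x - 1‖ < 1 / 4 := by
  obtain ⟨x, hxK, hxζ, hxR, hxc, p, hp, hpK, hpx⟩ := hF.exists_separating hK hf hζ hε
  refine ⟨x, hxK, hxζ, ?_⟩
  set ξ := f^[N] x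
  let V : Set ℂ := {z | ‖p z‖ < 1 / 2} ∩ Metric.ball c r
  have hVo : IsOpen V :=
    (isOpen_lt hp.continuous.norm continuous_const).inter Metric.isOpen_ball
  obtain ⟨e, he, heV⟩ := (hK.1.image (hf.continuous.iterate N)).exists_thickening_subset_open hVo
    (by rintro _ ⟨z, hz, rfl⟩; exact ⟨hpK z hz, hF.mem_ball z hz⟩)
  set d : ℝ := e / 3 with hd
  have hd0 : 0 < d := by positivity
  let Ω : Set ℂ := Metric.thickening d (f^[N] '' K)
  have hΩV : ∀ w ∈ Ω, ∀ w' ∈ Metric.ball w (2 * d), w' ∈ V := by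
    intro w hw w' hw'
    obtain ⟨y, hy, hwy⟩ := Metric.mem_thickening_iff.mp hw
    refine heV (Metric.mem_thickening_iff.mpr ⟨y, hy, ?_⟩)
    have := dist_triangle w' w y
    have := Metric.mem_ball.mp hw'
    linarith
  obtain ⟨δ, hδ, hδs, hδ1⟩ : ∃ δ : ℝ, 0 < δ ∧ δ * r < s / 3 ∧ δ * r < 1 / 16 := by
    have h0 : 0 < min (s / 3) (1 / 16) := by positivity
    refine ⟨min (s / 3) (1 / 16) / (2 * r), by positivity, ?_, ?_⟩ <;>
    · have : min (s / 3) (1 / 16) / (2 * r) * r = min (s / 3) (1 / 16) / 2 := by field_simp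
      rw [this]
      linarith [min_le_left (s / 3) (1 / 16), min_le_right (s / 3) (1 / 16)]
  obtain ⟨m, hm1, hm2⟩ : ∃ m : ℕ, (1 / 2 : ℝ) ^ m * ‖1 - v‖ ≤ δ * d / 8 ∧
      (1 / 2 : ℝ) ^ m * ‖1 - v‖ ≤ s / 3 := by
    obtain ⟨m, hm⟩ := exists_pow_lt_of_lt_one
      (show 0 < min (δ * d / 8) (s / 3) / (‖1 - v‖ + 1) by positivity)
      (show (1 / 2 : ℝ) < 1 by norm_num)
    rw [lt_div_iff₀ (by positivity)] at hm
    have : (0 : ℝ) < (1 / 2) ^ m := by positivity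
    exact ⟨m, by linarith [min_le_left (δ * d / 8) (s / 3)],
      by linarith [min_le_right (δ * d / 8) (s / 3)]⟩
  -- The power `p ^ m` is negligible on the image of `K` but equals `1` at `ξ`, where it replaces
  -- `v` by `1`. The linear term with slope `δ ≠ 0` keeps the map nearly affine, as later stages
  -- require.
  let g : ℂ → ℂ := fun z => v + δ * (z - c) + (1 - v) * p z ^ m
  have hg : Differentiable ℂ g := by fun_prop
  have hpow : ∀ z ∈ V, ‖(1 - v) * p z ^ m‖ ≤ (1 / 2 : ℝ) ^ m * ‖1 - v‖ := by
    intro z hz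
    rw [norm_mul, norm_pow, mul_comm]
    gcongr
    exact hz.1.le
  have hlin : ∀ z ∈ Metric.ball c r, ‖(δ : ℂ) * (z - c)‖ ≤ δ * r := by
    intro z hz
    rw [norm_mul, Complex.norm_real, Real.norm_eq_abs, abs_of_pos hδ]
    gcongr
    exact (mem_ball_iff_norm.mp hz).le
  have hgξ : ‖g ξ - 1‖ < 1 / 8 := by
    have : g ξ - 1 = δ * (ξ - c) := by simp only [g, hpx]; ring
    rw [this]
    linarith [hlin ξ hxc]
  obtain ⟨τ₁, hτ₁, H₁⟩ := exists_iterate_mem_at hf.continuous hK.1 hF.norm_lt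
    (O := Ω) Metric.isOpen_thickening
    (fun z hz => Metric.self_subset_thickening hd0 _ (mem_image_of_mem _ hz))
  obtain ⟨τ₂, hτ₂, H₂⟩ := exists_iterate_mem_at hf.continuous (isCompact_singleton (x := x))
    (R := R) (N := N) (fun i hi z hz => by rw [mem_singleton_iff.mp hz]; exact hxR i hi)
    (O := Metric.ball c r ∩ {z | ‖g z - 1‖ < 1 / 8})
    (Metric.isOpen_ball.inter (isOpen_lt (hg.continuous.sub continuous_const).norm continuous_const))
    (fun z hz => by rw [mem_singleton_iff.mp hz]; exact ⟨hxc, hgξ⟩)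
  obtain ⟨τ, hτ, hτa, hτb, hτc, hτd, hτe⟩ : ∃ τ : ℝ, 0 < τ ∧ τ ≤ τ₁ ∧ τ ≤ τ₂ ∧ τ ≤ δ * d / 8 ∧
      τ < s / 3 ∧ τ ≤ 1 / 8 := by
    have : ∀ᶠ τ in 𝓝[>] (0 : ℝ), 0 < τ ∧ τ < τ₁ ∧ τ < τ₂ ∧ τ < δ * d / 8 ∧ τ < s / 3 ∧ τ < 1 / 8 := by
      refine eventually_mem_nhdsWithin.and ?_
      refine Eventually.filter_mono nhdsWithin_le_nhds ?_
      refine (eventually_lt_nhds hτ₁).and <| (eventually_lt_nhds hτ₂).and <|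
        (eventually_lt_nhds (by positivity)).and <| (eventually_lt_nhds (by positivity)).and <|
        eventually_lt_nhds (by positivity)
    obtain ⟨τ, h1, h2, h3, h4, h5, h6⟩ := this.exists
    exact ⟨τ, h1, h2.le, h3.le, h4.le, h5, h6.le⟩
  refine ⟨g, hg, Ω, Metric.isOpen_thickening, τ, hτ, fun h hhf hhg => ?_⟩
  have hΩ := H₁ h (hhf.mono le_rfl hτa)
  have hx := H₂ h (hhf.mono le_rfl hτb) x rfl
  refine ⟨hΩ, ⟨δ, v - δ * c, d, by exact_mod_cast hδ.ne', hd0, fun w hw w' hw' => ?_⟩,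
    fun z hz => ?_, hx.1, ?_⟩
  · have hV := hΩV w hw w' hw'
    have h1 := hhg w' (Metric.ball_subset_closedBall hV.2)
    have h2 := hpow w' hV
    have e1 : h w' - (δ * w' + (v - δ * c)) = (h w' - g w') + (1 - v) * p w' ^ m := by
      simp only [g]; ring
    rw [e1, Complex.norm_real, Real.norm_eq_abs, abs_of_pos hδ]
    linarith [norm_add_le (h w' - g w') ((1 - v) * p w' ^ m)]
  · have hV := hΩV _ (hΩ z hz) _ (Metric.mem_ball_self (by positivity))
    rw [Function.iterate_succ_apply', mem_ball_iff_norm]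
    set y := h^[N] z
    have h1 := hhg y (Metric.ball_subset_closedBall hV.2)
    have h2 := hpow y hV
    have h3 := hlin y hV.2
    have e1 : h y - v = (h y - g y) + (δ * (y - c) + (1 - v) * p y ^ m) := by
      simp only [g]; ring
    rw [e1]
    linarith [norm_add_le (h y - g y) (δ * (y - c) + (1 - v) * p y ^ m),
      norm_add_le (δ * (y - c)) ((1 - v) * p y ^ m)]
  · rw [Function.iterate_succ_apply']
    have h1 := hhg _ (Metric.ball_subset_closedBall hx.1)
    have h2 : ‖g (h^[N] x) - 1‖ < 1 / 8 := hx.2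
    linarith [norm_sub_le_norm_sub_add_norm_sub (h (h^[N] x)) (g (h^[N] x)) 1]

/-- An orbit segment through noncritical points is followed by nearby points under nearby maps. -/
theorem exists_segment_followed {f : ℂ → ℂ} (hf : Differentiable ℂ f) {R : ℝ} {L : ℕ} {v : ℂ}
    (hR : ∀ j < L, ‖f^[j] v‖ < R) (hd : ∀ j < L, deriv f (f^[j] v) ≠ 0) {O : ℕ → Set ℂ}
    (hO : ∀ j ≤ L, IsOpen (O j)) (hv : ∀ j ≤ L, f^[j] v ∈ O j) :
    ∃ s > 0, ∃ τ > 0, ∀ h : ℂ → ℂ, CloseOn R τ f h →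
      (∀ p ∈ Metric.ball v s, ∀ j ≤ L, h^[j] p ∈ O j) ∧
      ∀ j < L, ∃ Ω, IsOpen Ω ∧ (∀ p ∈ Metric.ball v s, h^[j] p ∈ Ω) ∧ NearAffineOn h Ω := by
  have hloc : ∀ j < L, ∃ s > 0, ∃ τ > 0, ∀ h : ℂ → ℂ, CloseOn R τ f h →
      NearAffineOn h (Metric.ball (f^[j] v) s) := by
    intro j hj
    obtain ⟨e, he, heR⟩ := Metric.isOpen_iff.mp (Metric.isOpen_ball (x := (0 : ℂ)) (ε := R))
      (f^[j] v) (by simpa using hR j hj)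
    obtain ⟨s, hs, τ, hτ, H⟩ := exists_nearAffineOn_ball hf (hd j hj) he
    exact ⟨s, hs, τ, hτ, fun h hh => H h fun z hz => hh z (mem_ball_zero_iff.mp (heR hz)).le⟩
  choose! s hs τ hτ H using hloc
  let O' : ℕ → Set ℂ := fun j => O j ∩ {z | j < L → ‖z‖ < R ∧ z ∈ Metric.ball (f^[j] v) (s j)}
  have hO' : ∀ j ≤ L, IsOpen (O' j) := by
    intro j hj
    refine (hO j hj).inter ?_
    by_cases h : j < L
    · simp only [h, forall_const]
      exact (isOpen_lt continuous_norm continuous_const).inter Metric.isOpen_ball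
    · simp [h]
  have hvO' : ∀ j ≤ L, f^[j] v ∈ O' j := fun j hj =>
    ⟨hv j hj, fun h => ⟨hR j h, Metric.mem_ball_self (hs j h)⟩⟩
  obtain ⟨t, ht, htO⟩ := Metric.isOpen_iff.mp
    (show IsOpen (⋂ j ∈ Iic L, f^[j] ⁻¹' O' j) from
      (finite_Iic L).isOpen_biInter fun j hj => (hO' j hj).preimage (hf.continuous.iterate j))
    v (mem_iInter₂.mpr hvO')
  have htO' : ∀ j ≤ L, ∀ z ∈ Metric.closedBall v (t / 2), f^[j] z ∈ O' j := fun j hj z hz =>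
    mem_iInter₂.mp (htO (Metric.closedBall_subset_ball (by linarith) hz)) j hj
  obtain ⟨η, hη, Hη⟩ := exists_iterate_mem hf.continuous (isCompact_closedBall v (t / 2))
    (fun j hj z hz => ((htO' j hj.le z hz).2 hj).1) hO' htO'
  obtain ⟨τ₀, hτ₀, hτ₀'⟩ : ∃ τ₀ > 0, ∀ j ∈ Iio L, τ₀ < τ j := by
    have := (eventually_all_finite (finite_Iio L)).mpr fun j hj =>
      (eventually_lt_nhds (hτ j hj)).filter_mono (nhdsWithin_le_nhds (s := Ioi 0))
    obtain ⟨τ₀, h1, h2⟩ := (this.and self_mem_nhdsWithin).exists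
    exact ⟨τ₀, h2, h1⟩
  refine ⟨t / 2, by positivity, min η τ₀, by positivity, fun h hh => ?_⟩
  have hmem := fun p hp j hj => Hη h (hh.mono le_rfl (min_le_left _ _)) j hj p
    (Metric.ball_subset_closedBall (x := v) (ε := t / 2) hp)
  refine ⟨fun p hp j hj => (hmem p hp j hj).1, fun j hj =>
    ⟨_, Metric.isOpen_ball, fun p hp => ((hmem p hp j hj.le).2 hj).2,
      H j hj h (hh.mono le_rfl ((min_le_right _ _).trans (hτ₀' j hj).le))⟩⟩

/-! ### The inductive construction and its limit. -/

/-- The data of one stage of the inductive construction: the current entire function `f`, the radius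
`R` of the disc on which it is only slightly changed later, the time `N` at which the compact set
has been moved to the disc of centre `c` and radius `r`, a point `q` with an orbit leaving the disc
of radius `R`, and the size `η` of the admissible changes. -/
structure StageData where
  f : ℂ → ℂ
  R : ℝ
  N : ℕ
  c : ℂ
  r : ℝ
  q : ℂ
  η : ℝ

/-- The tolerance `η` is counted inside `near`, and `follows` is demanded of every `η`-close map, so
both survive all later changes. The unit of room in `path_end` allows the map to be changed near the
end of the path without affecting the disc about `c`. -/
structure IsStage (K : Set ℂ) (ρ : ℝ) (k : ℕ) (s : StageData) : Prop where
  differentiable : Differentiable ℂ s.f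
  le_R : ρ ≤ s.R
  near : ∀ z, ‖z‖ ≤ ρ → ‖s.f z - basePoly z‖ + s.η ≤ 1 / 10
  η_pos : 0 < s.η
  glue : IsGlueDisc s.R s.c s.r
  follows : ∀ g, CloseOn s.R s.η s.f g → Follows K s.R s.N s.c s.r g
  q_lt : ‖s.q‖ < ρ
  path : ∀ i, 1 ≤ i → i ≤ k → ρ < ‖s.f^[i] s.q‖ ∧ ‖s.f^[i] s.q‖ < s.R
  path_end : ‖s.c‖ + s.r + 1 < ‖s.f^[k + 1] s.q‖

/-- What the map `g` does with `K` and with `x` between the times `N` and `N + L + 1`. -/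
structure StageBehaviour (K : Set ℂ) (ρ : ℝ) (k : ℕ) (σ : Option ℕ) (R : ℝ) (N : ℕ) (x : ℂ)
    (g : ℂ → ℂ) : Prop where
  outside : ∀ z ∈ K, R < ‖g^[N] z‖
  region : ∀ j ≤ stageLength k σ, ∀ z ∈ K, g^[N + 1 + j] z ∈ stageRegion ρ σ j
  dist_le : ∀ j ≤ stageLength k σ, ∀ z ∈ K, ∀ w ∈ K,
    dist (g^[N + 1 + j] z) (g^[N + 1 + j] w) ≤ 1 / (k + 1)
  inside : ∀ j < stageLength k σ, ∀ z ∈ K, ‖g^[N + 1 + j] z‖ < R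
  point_outside : R < ‖g^[N] x‖
  point_trapped : ‖g^[N + 1] x - 1‖ < 1 / 4

structure IsStep (K : Set ℂ) (ρ : ℝ) (k : ℕ) (σ : Option ℕ) (s s' : StageData) (x : ℂ) : Prop where
  N_eq : s'.N = s.N + stageLength k σ + 1
  η_le : s'.η ≤ s.η / 2
  R_le : s.R + 1 ≤ s'.R
  close : CloseOn s.R (s.η / 2) s.f s'.f
  behaviour : ∀ g, CloseOn s'.R s'.η s'.f g → StageBehaviour K ρ k σ s.R s.N x g

theorem IsGlueDisc.lt_norm {R r : ℝ} {c z : ℂ} (h : IsGlueDisc R c r) (hz : z ∈ Metric.ball c r) :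
    R < ‖z‖ := by
  have := h.2.2.1
  have h1 := mem_ball_iff_norm.mp hz
  have h2 := norm_sub_norm_le c z
  rw [norm_sub_rev] at h2
  linarith

/-- Two gluings are made: the local model near `c`, and a large constant `b` near the end `u` of the
path of `q`. Both lie beyond the disc of radius `R`, where `f` is almost unchanged, so the orbits of
`v` and `q` persist. -/
theorem IsStage.exists_step {K : Set ℂ} (hK : IsFullCompact K) {ρ : ℝ} (hρ : 10 ≤ ρ) {k : ℕ}
    {s : StageData} (hs : IsStage K ρ k s) {ζ : ℂ} (hζ : ζ ∈ frontier K) (σ : Option ℕ) :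
    ∃ s' x, IsStage K ρ (k + 1) s' ∧ x ∉ K ∧ dist x ζ < 1 / (k + 1) ∧ IsStep K ρ k σ s s' x := by
  obtain ⟨hf, hρR, hnear, hη, hglue, hfol, hq, hpath, hend⟩ := hs
  set f := s.f
  set R := s.R
  set N := s.N
  set c := s.c
  set r := s.r
  set q := s.q
  set L := stageLength k σ with hL
  set u := f^[k + 1] q with hu
  have hr : 0 < r := hglue.1
  have hcR : R + r < ‖c‖ := hglue.2.2.1
  have hk : (0 : ℝ) < 1 / (2 * (k + 1)) := by positivity
  obtain ⟨v, hvR, hvu, hvd, hvσ⟩ := exists_stage_orbit hf hρ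
    (fun z hz => by linarith [hnear z hz]) hρR hq hpath (by linarith) σ
  set w := f^[L] v with hw
  -- the disc about `u` on which the new map is nearly constant
  obtain ⟨t₀, ht₀⟩ := exists_isGlueDisc (R := ‖u‖ - 1) (c := u) (by linarith) (by linarith)
  -- The disc about `u` must lie inside the new radius `R'`, which is halfway between `‖u‖` and
  -- `‖w‖`.
  have ht_pos : 0 < min t₀ ((‖w‖ - ‖u‖) / 3) := lt_min ht₀.1 (by linarith)
  have ht := ht₀.mono ht_pos (min_le_left _ _)
  have ht' : min t₀ ((‖w‖ - ‖u‖) / 3) ≤ (‖w‖ - ‖u‖) / 3 := min_le_right _ _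
  set t := min t₀ ((‖w‖ - ‖u‖) / 3)
  have htu := ht.2.2.1
  -- the new radius and the new disc
  obtain ⟨R', hR'⟩ : ∃ R' : ℝ, R' = ‖u‖ + (‖w‖ - ‖u‖) / 2 := ⟨_, rfl⟩
  obtain ⟨r₀, hr₀⟩ := exists_isGlueDisc (R := R') (c := w) (by linarith) (by linarith)
  have hr' := hr₀.mono (lt_min hr₀.1 hk) (min_le_left _ _)
  have hr'k : min r₀ (1 / (2 * (k + 1))) ≤ 1 / (2 * ((k : ℝ) + 1)) := min_le_right _ _
  set r' := min r₀ (1 / (2 * ((k : ℝ) + 1)))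
  -- the orbit segment of `v`
  let O : ℕ → Set ℂ := fun j => (stageRegion ρ σ j ∩ Metric.ball (f^[j] v) (1 / (2 * (k + 1)))) ∩
    {z | (j < L → ‖z‖ < R) ∧ (j = L → z ∈ Metric.ball w r')}
  have hO : ∀ j ≤ L, IsOpen (O j) := by
    intro j hj
    refine ((isOpen_stageRegion ρ σ j).inter Metric.isOpen_ball).inter ?_
    rcases hj.lt_or_eq with h | h
    · simp only [h, h.ne, forall_const, IsEmpty.forall_iff, and_true]
      exact isOpen_lt continuous_norm continuous_const
    · simp only [h, lt_irrefl, forall_const, IsEmpty.forall_iff, true_and]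
      exact Metric.isOpen_ball
  have hvO : ∀ j ≤ L, f^[j] v ∈ O j := fun j hj =>
    ⟨⟨hvσ j hj, Metric.mem_ball_self hk⟩, fun h => hvR j h, fun h => by
      subst h; exact Metric.mem_ball_self hr'.1⟩
  obtain ⟨e, he, τ₁, hτ₁, H₁⟩ := exists_segment_followed hf hvR hvd hO hvO
  -- the local model near the image of `K`
  obtain ⟨x, hxK, hxζ, g, hg, Ω, hΩo, τ₂, hτ₂, H₂⟩ := Follows.exists_local_model hK hf
    (hfol f (fun z _ => by simpa using hη.le)) hr hζ
    (show (0 : ℝ) < 1 / (k + 1) by positivity) v he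
  -- the orbit of `q`
  obtain ⟨τ₃, hτ₃, H₃⟩ := exists_iterate_mem hf.continuous (isCompact_singleton (x := q)) (R := R)
    (N := k + 1) (fun i hi z hz => by
      rw [mem_singleton_iff.mp hz]
      rcases Nat.eq_zero_or_pos i with rfl | h
      · exact hq.trans_le hρR
      · exact (hpath i h (by omega)).2)
    (O := fun i => {z | 1 ≤ i → i ≤ k → ρ < ‖z‖ ∧ ‖z‖ < R} ∩ {z | i = k + 1 → z ∈ Metric.ball u t})
    (fun i _ => by
      refine IsOpen.inter ?_ ?_
      · by_cases h : 1 ≤ i ∧ i ≤ k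
        · simp only [h.1, h.2, forall_const]
          exact (isOpen_lt continuous_const continuous_norm).inter
            (isOpen_lt continuous_norm continuous_const)
        · have : ∀ z : ℂ, (1 ≤ i → i ≤ k → ρ < ‖z‖ ∧ ‖z‖ < R) := fun z h1 h2 => absurd ⟨h1, h2⟩ h
          rw [eq_univ_of_forall fun z => this z]
          exact isOpen_univ
      · by_cases h : i = k + 1
        · simp only [h, forall_const]; exact Metric.isOpen_ball
        · simp [h])
    (fun i _ z hz => by
      rw [mem_singleton_iff.mp hz]
      exact ⟨fun h1 h2 => hpath i h1 h2, fun h => by subst h; exact Metric.mem_ball_self ht.1⟩)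
  -- the new function
  obtain ⟨τ, hτ, hτa, hτb, hτc, hτd, hτe⟩ : ∃ τ : ℝ, 0 < τ ∧ 3 * τ ≤ τ₁ ∧ 3 * τ ≤ τ₂ ∧ 3 * τ ≤ τ₃ ∧
      3 * τ ≤ s.η / 2 ∧ 3 * τ ≤ 1 := by
    refine ⟨min τ₁ (min τ₂ (min τ₃ (min (s.η / 2) 1))) / 3, by positivity, ?_, ?_, ?_, ?_, ?_⟩ <;>
      rw [mul_div_cancel₀ _ (by norm_num : (3 : ℝ) ≠ 0)] <;> simp
  -- The path of `q` must next land beyond the new disc about `w` with a margin exceeding `1`,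
  -- despite the gluing error.
  obtain ⟨b, hb⟩ : ∃ b : ℂ, ‖b‖ = ‖w‖ + r' + 3 := by
    refine ⟨((‖w‖ + r' + 3 : ℝ) : ℂ), ?_⟩
    rw [Complex.norm_real, Real.norm_eq_abs, abs_of_pos]
    have := norm_nonneg w
    linarith [hr'.1]
  -- Each gluing costs `τ`, and a map `τ`-close to `F` costs another; hence the tolerances `3 * τ`.
  obtain ⟨F₁, hF₁, hF₁f, hF₁g⟩ := hglue.exists_approx hf hg hτ
  obtain ⟨F, hF, hFF₁, hFb⟩ := ht.exists_approx hF₁ (differentiable_const b) hτ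
  have hcu : ∀ z ∈ Metric.closedBall c r, ‖z‖ ≤ ‖u‖ - 1 := by
    intro z hz
    have h1 := mem_closedBall_iff_norm.mp hz
    have h2 := norm_sub_norm_le z c
    linarith
  have hFf : CloseOn R (2 * τ) f F := fun z hz => by
    linarith [hF₁f z hz, hFF₁ z (by linarith), norm_sub_le_norm_sub_add_norm_sub (F z) (F₁ z) (f z)]
  have hFg : ∀ z ∈ Metric.closedBall c r, ‖F z - g z‖ ≤ 2 * τ := fun z hz => by
    linarith [hF₁g z hz, hFF₁ z (hcu z hz), norm_sub_le_norm_sub_add_norm_sub (F z) (F₁ z) (g z)]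
  have hRR' : R + 1 ≤ R' := by linarith
  have hhf : ∀ h, CloseOn R' τ F h → CloseOn R (3 * τ) f h := fun h hh =>
    (hFf.trans (hh.mono (by linarith) le_rfl)).mono le_rfl (by linarith)
  have hhg : ∀ h, CloseOn R' τ F h → ∀ z ∈ Metric.closedBall c r, ‖h z - g z‖ ≤ τ₂ := by
    intro h hh z hz
    linarith [hFg z hz, hh z (by linarith [hcu z hz]),
      norm_sub_le_norm_sub_add_norm_sub (h z) (F z) (g z)]
  have hseg : ∀ h, CloseOn R' τ F h → ∀ z ∈ K, ∀ j ≤ L, h^[N + 1 + j] z ∈ O j := by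
    intro h hh z hz j hj
    rw [add_comm (N + 1), Function.iterate_add_apply]
    exact (H₁ h ((hhf h hh).mono le_rfl hτa)).1 _
      ((H₂ h ((hhf h hh).mono le_rfl hτb) (hhg h hh)).2.2.1 z hz) j hj
  have hfolh : ∀ h, CloseOn R' τ F h → Follows K R N c r h := fun h hh =>
    hfol h ((hhf h hh).mono le_rfl (by linarith))
  have hFF : CloseOn R' τ F F := fun z _ => by simpa using hτ.le
  have hq3 := H₃ F (hFf.mono le_rfl (by linarith))
  have hqu : F^[k + 1] q ∈ Metric.ball u t := (hq3 (k + 1) le_rfl q rfl).2 rfl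
  refine ⟨⟨F, R', N + L + 1, w, r', q, τ⟩, x, ⟨hF, by dsimp only; linarith, fun z hz => ?_, hτ, hr',
    fun h hh => ⟨fun i hi z hz => ?_, fun i hi => ?_, fun z hz => ?_⟩, hq, fun i h1 h2 => ?_, ?_⟩,
    hxK, hxζ, ⟨rfl, by dsimp only; linarith, hRR', hFf.mono le_rfl (by linarith), fun h hh => ?_⟩⟩
  · dsimp only
    linarith [hnear z hz, hFf z (hz.trans hρR),
      norm_sub_le_norm_sub_add_norm_sub (F z) (f z) (basePoly z)]
  · dsimp only at hi ⊢
    rcases lt_trichotomy i N with h1 | rfl | h1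
    · linarith [(hfolh h hh).norm_lt i h1 z hz]
    · linarith [norm_lt_of_mem_ball ((hfolh h hh).mem_ball z hz)]
    · obtain ⟨j, rfl⟩ : ∃ j, i = N + 1 + j := ⟨i - (N + 1), by omega⟩
      have hjL : j < L := by omega
      linarith [(hseg h hh z hz j hjL.le).2.1 hjL]
  · dsimp only at hi
    have h2 := H₂ h ((hhf h hh).mono le_rfl hτb) (hhg h hh)
    rcases lt_trichotomy i N with h1 | rfl | h1
    · exact (hfolh h hh).nearAffine i h1
    · exact ⟨Ω, hΩo, h2.1, h2.2.1⟩
    · obtain ⟨j, rfl⟩ : ∃ j, i = N + 1 + j := ⟨i - (N + 1), by omega⟩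
      obtain ⟨Ω', hΩ'o, hΩ', hΩ'h⟩ := (H₁ h ((hhf h hh).mono le_rfl hτa)).2 j (by omega)
      refine ⟨Ω', hΩ'o, fun z hz => ?_, hΩ'h⟩
      rw [add_comm (N + 1), Function.iterate_add_apply]
      exact hΩ' _ (h2.2.2.1 z hz)
  · have := (hseg h hh z hz L le_rfl).2.2 rfl
    rwa [show N + 1 + L = N + L + 1 by ring] at this
  · dsimp only
    rcases Nat.lt_or_ge k i with h3 | h3
    · obtain rfl : i = k + 1 := by omega
      have h4 := ht.lt_norm hqu
      have h5 := norm_lt_of_mem_ball hqu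
      exact ⟨by linarith, by linarith⟩
    · have := (hq3 i (by omega) q rfl).1 h1 h3
      exact ⟨this.1, by linarith⟩
  · dsimp only
    rw [Function.iterate_succ_apply']
    have h1 := hFb _ (Metric.ball_subset_closedBall hqu)
    have h2 := norm_sub_norm_le b (F (F^[k + 1] q))
    rw [norm_sub_rev] at h2
    linarith
  · have h2 := H₂ h ((hhf h hh).mono le_rfl hτb) (hhg h hh)
    refine ⟨fun z hz => hglue.lt_norm ((hfolh h hh).mem_ball z hz),
      fun j hj z hz => (hseg h hh z hz j hj).1.1, fun j hj z hz y hy => ?_,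
      fun j hj z hz => (hseg h hh z hz j hj.le).2.1 hj, hglue.lt_norm h2.2.2.2.1, h2.2.2.2.2⟩
    have h3 := Metric.mem_ball.mp (hseg h hh z hz j hj).1.2
    have h4 := Metric.mem_ball'.mp (hseg h hh y hy j hj).1.2
    refine (dist_triangle _ (f^[j] v) _).trans ((add_le_add h3.le h4.le).trans_eq ?_)
    field_simp
    norm_num

/-- As `basePoly z = 1 - (1 - z) ^ 2`, the point `1 - ρ` of the central disc goes to `1 - ρ ^ 2`,
far beyond `K`. The exponent `2` suffices for the glue disc since `(ρ / (2 * ρ)) ^ 2 = 1 / 4`. -/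
theorem isStage_base {K : Set ℂ} {ρ : ℝ} (hρ : 10 ≤ ρ)
    (hK : K ⊆ Metric.ball ((2 * ρ : ℝ) : ℂ) (ρ / 5)) :
    IsStage K ρ 0 ⟨basePoly, ρ, 0, (2 * ρ : ℝ), ρ / 5, ((1 - ρ : ℝ) : ℂ), 1 / 10⟩ := by
  have hρ0 : 0 < ρ := by linarith
  have hn : ‖((2 * ρ : ℝ) : ℂ)‖ = 2 * ρ := by
    rw [Complex.norm_real, Real.norm_eq_abs, abs_of_pos (by linarith)]
  refine ⟨?_, le_rfl, fun z _ => by simp, by norm_num, ⟨by positivity, ?_, ?_, 2, fun z hz => ?_,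
    fun z hz => ?_⟩, fun g hg => ⟨fun i hi => by simp at hi, fun i hi => by simp at hi,
    fun z hz => hK hz⟩, ?_, fun i h1 h2 => by omega, ?_⟩
  · unfold basePoly; fun_prop
  · rw [← norm_pos_iff]; dsimp only; rw [hn]; linarith
  · dsimp only; rw [hn]; linarith
  · dsimp only at hz ⊢
    rw [norm_pow, norm_div, hn]
    have : ‖z‖ / (2 * ρ) ≤ 1 / 2 := by rw [div_le_iff₀ (by positivity)]; linarith
    calc (‖z‖ / (2 * ρ)) ^ 2 ≤ (1 / 2) ^ 2 := by gcongr
      _ = 1 / 4 := by norm_num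
  · dsimp only at hz ⊢
    have hne : ((2 * ρ : ℝ) : ℂ) ≠ 0 := by exact_mod_cast (by positivity : 2 * ρ ≠ 0)
    set c : ℂ := ((2 * ρ : ℝ) : ℂ)
    have e : (z / c) ^ 2 - 1 = (z - c) / c * (2 + (z - c) / c) := by field_simp; ring
    have h1 : ‖(z - c) / c‖ ≤ 1 / 10 := by
      rw [norm_div, hn, div_le_iff₀ (by positivity)]
      linarith [mem_closedBall_iff_norm.mp hz]
    rw [e, norm_mul]
    calc ‖(z - c) / c‖ * ‖2 + (z - c) / c‖ ≤ 1 / 10 * (2 + 1 / 10) := by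
          gcongr
          exact (norm_add_le _ _).trans (by norm_num at h1 ⊢; linarith)
      _ ≤ 1 / 4 := by norm_num
  · dsimp only
    rw [Complex.norm_real, Real.norm_eq_abs, abs_of_neg (by linarith)]
    linarith
  · dsimp only
    have : basePoly^[0 + 1] ((1 - ρ : ℝ) : ℂ) = ((1 - ρ ^ 2 : ℝ) : ℂ) := by
      simp only [basePoly, zero_add, Function.iterate_one]; push_cast; ring
    rw [hn, this, Complex.norm_real, Real.norm_eq_abs, abs_of_neg (by nlinarith)]
    nlinarith

/-- The entire function obtained as the limit of the inductive construction. -/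
theorem exists_entire_stageBehaviour {K : Set ℂ} (hK : IsFullCompact K) {ρ : ℝ} (hρ : 10 ≤ ρ)
    (hKρ : K ⊆ Metric.ball ((2 * ρ : ℝ) : ℂ) (ρ / 5)) (σ : ℕ → Option ℕ) {ζ : ℕ → ℂ}
    (hζ : ∀ k, ζ k ∈ frontier K) :
    ∃ (f : ℂ → ℂ) (N : ℕ → ℕ) (R : ℕ → ℝ) (x : ℕ → ℂ), Differentiable ℂ f ∧
      (∀ z, ‖z‖ ≤ ρ → ‖f z - basePoly z‖ ≤ 1 / 10) ∧ N 0 = 0 ∧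
      (∀ k, N (k + 1) = N k + stageLength k (σ k) + 1) ∧ (∀ k : ℕ, (k : ℝ) ≤ R k) ∧
      (∀ k, ρ ≤ R k) ∧ (∀ k, x k ∉ K ∧ dist (x k) (ζ k) < 1 / (k + 1)) ∧
      ∀ k, StageBehaviour K ρ k (σ k) (R k) (N k) (x k) f := by
  have step : ∀ k s, ∃ s' x, IsStage K ρ k s → IsStage K ρ (k + 1) s' ∧ x ∉ K ∧
      dist x (ζ k) < 1 / (k + 1) ∧ IsStep K ρ k (σ k) s s' x := by
    intro k s
    by_cases h : IsStage K ρ k s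
    · obtain ⟨s', x, h'⟩ := h.exists_step hK hρ (hζ k) (σ k)
      exact ⟨s', x, fun _ => h'⟩
    · exact ⟨s, 0, fun h' => absurd h' h⟩
  choose T X hTX using step
  let S : ℕ → StageData := fun k =>
    Nat.rec ⟨basePoly, ρ, 0, (2 * ρ : ℝ), ρ / 5, ((1 - ρ : ℝ) : ℂ), 1 / 10⟩ (fun k s => T k s) k
  have hS : ∀ k, IsStage K ρ k (S k) := by
    intro k
    induction k with
    | zero => exact isStage_base hρ hKρ
    | succ k ih => exact (hTX k (S k) ih).1
  have hstep : ∀ k, IsStep K ρ k (σ k) (S k) (S (k + 1)) (X k (S k)) :=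
    fun k => (hTX k (S k) (hS k)).2.2.2
  have hR : ∀ k : ℕ, (k : ℝ) ≤ (S k).R := by
    intro k
    induction k with
    | zero => exact_mod_cast (by linarith : (0 : ℝ) ≤ ρ).trans (hS 0).le_R
    | succ k ih => push_cast; linarith [(hstep k).R_le]
  have hRmono : Monotone fun k => (S k).R :=
    monotone_nat_of_le_succ fun k => by linarith [(hstep k).R_le]
  have hη : ∀ k, (S k).η ≤ 1 / 10 * (1 / 2) ^ k := by
    intro k
    induction k with
    | zero => simp [S]
    | succ k ih => rw [pow_succ]; linarith [(hstep k).η_le]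
  -- Subtracting the remaining tolerance makes the induction close: a change of `η / 2` is paid for
  -- by the halving of `η`.
  have hclose : ∀ j m, CloseOn (S j).R ((S j).η - (S (j + m)).η) (S j).f (S (j + m)).f := by
    intro j m
    induction m with
    | zero => intro z _; simp
    | succ m ih =>
      refine (ih.trans ((hstep (j + m)).close.mono (hRmono (Nat.le_add_right j m)) le_rfl)).mono
        le_rfl ?_
      rw [← add_assoc]
      linarith [(hstep (j + m)).η_le]
  have hclose' : ∀ j k, j ≤ k → CloseOn (S j).R (S j).η (S j).f (S k).f := by
    intro j k hjk
    obtain ⟨m, rfl⟩ := Nat.exists_eq_add_of_le hjk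
    exact (hclose j m).mono le_rfl (by linarith [(hS (j + m)).η_pos])
  have hη0 : ∀ ε > 0, ∃ j₀, ∀ j ≥ j₀, (S j).η < ε := by
    intro ε hε
    have ht : Tendsto (fun j : ℕ => (1 / 10 : ℝ) * (1 / 2) ^ j) atTop (𝓝 0) := by
      simpa using (tendsto_pow_atTop_nhds_zero_of_lt_one (r := (1 / 2 : ℝ)) (by norm_num)
        (by norm_num)).const_mul (1 / 10 : ℝ)
    obtain ⟨j₀, hj₀⟩ := eventually_atTop.mp (ht.eventually_lt_const hε)
    exact ⟨j₀, fun j hj => (hη j).trans_lt (hj₀ j hj)⟩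
  have hlim : ∀ z, ∃ w, Tendsto (fun k => (S k).f z) atTop (𝓝 w) := by
    intro z
    refine cauchySeq_tendsto_of_complete (Metric.cauchySeq_iff'.mpr fun ε hε => ?_)
    obtain ⟨j₀, hj₀⟩ := hη0 ε hε
    obtain ⟨j₁, hj₁⟩ := exists_nat_ge ‖z‖
    refine ⟨max j₀ j₁, fun k hk => ?_⟩
    rw [dist_eq_norm]
    refine (hclose' _ k hk z ?_).trans_lt (hj₀ _ (le_max_left _ _))
    exact hj₁.trans ((hR j₁).trans (hRmono (le_max_right _ _)))
  choose f hf using hlim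
  have hfclose : ∀ j, CloseOn (S j).R (S j).η (S j).f f := by
    intro j z hz
    refine le_of_tendsto ((hf z).sub_const _).norm ?_
    filter_upwards [eventually_ge_atTop j] with k hk
    exact hclose' j k hk z hz
  have hunif : TendstoLocallyUniformlyOn (fun k => (S k).f) f atTop univ := by
    rw [Metric.tendstoLocallyUniformlyOn_iff]
    intro ε hε z _
    obtain ⟨j₀, hj₀⟩ := hη0 ε hε
    obtain ⟨j₁, hj₁⟩ := exists_nat_ge (‖z‖ + 1)
    refine ⟨Metric.ball z 1, mem_nhdsWithin_of_mem_nhds (Metric.ball_mem_nhds z one_pos), ?_⟩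
    filter_upwards [eventually_ge_atTop (max j₀ j₁)] with k hk y hy
    rw [dist_eq_norm]
    refine (hfclose k y ?_).trans_lt (hj₀ k ((le_max_left _ _).trans hk))
    have h1 := hRmono ((le_max_right _ _).trans hk)
    dsimp only at h1
    linarith [norm_lt_of_mem_ball hy, hR j₁]
  refine ⟨f, fun k => (S k).N, fun k => (S k).R, fun k => X k (S k), ?_, fun z hz => ?_, rfl,
    fun k => (hstep k).N_eq, hR, fun k => (hS k).le_R, fun k => ?_, fun k => ?_⟩
  · exact differentiableOn_univ.mp (hunif.differentiableOn
      (Eventually.of_forall fun k => (hS k).differentiable.differentiableOn) isOpen_univ)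
  · have := hfclose 0 z hz
    simp only [S] at this
    exact this
  · exact ⟨(hTX k (S k) (hS k)).2.1, (hTX k (S k) (hS k)).2.2.1⟩
  · exact (hstep k).behaviour f (hfclose (k + 1))

/-! ### Criteria for normality, Fatou components, wandering and transcendence. -/

/-- If the iterates used have orders tending to infinity, their oscillation on `U` vanishes, so the
values at one point `z₀` decide between a constant limit and infinity. Otherwise one iterate recurs
infinitely often. -/
theorem isNormalFamilyOn_iterates {f : ℂ → ℂ} {U : Set ℂ}
    (h : ∀ ε > 0, ∀ᶠ n in atTop, ∀ z ∈ U, ∀ w ∈ U, dist (f^[n] z) (f^[n] w) ≤ ε) :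
    IsNormalFamilyOn (range fun n : ℕ => f^[n]) U := by
  intro g hg
  choose n hn using hg
  rcases U.eq_empty_or_nonempty with rfl | ⟨z₀, hz₀⟩
  · exact ⟨id, strictMono_id, Or.inl ⟨0, by simp [TendstoLocallyUniformlyOn]⟩⟩
  by_cases hrep : ∃ m, ∃ᶠ k in atTop, n k = m
  · obtain ⟨m, hm⟩ := hrep
    obtain ⟨φ, hφ, hφm⟩ := extraction_of_frequently_atTop hm
    refine ⟨φ, hφ, Or.inl ⟨f^[m], ?_⟩⟩
    rw [Metric.tendstoLocallyUniformlyOn_iff]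
    refine fun ε hε z _ => ⟨univ, univ_mem, Eventually.of_forall fun k y _ => ?_⟩
    rw [← hn, hφm, dist_self]
    exact hε
  · push Not at hrep
    have hn_top : Tendsto n atTop atTop := by
      refine tendsto_atTop.mpr fun b => ?_
      filter_upwards [(eventually_all_finite (finite_Iio b)).mpr fun m _ => hrep m] with k hk
      by_contra hlt
      exact hk (n k) (not_le.mp hlt) rfl
    by_cases htop : Tendsto (fun k => ‖g k z₀‖) atTop atTop
    · refine ⟨id, strictMono_id, Or.inr fun C hC _ R => ?_⟩
      filter_upwards [hn_top.eventually (h 1 one_pos), htop.eventually_gt_atTop (R + 1)]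
        with k h1 h2 z hz
      have h3 := h1 z₀ hz₀ z (hC hz)
      simp only [← hn, id_eq] at h2 ⊢
      rw [dist_eq_norm] at h3
      linarith [norm_sub_norm_le (f^[n k] z₀) (f^[n k] z)]
    · rw [tendsto_atTop] at htop
      push Not at htop
      obtain ⟨B, hB⟩ := htop
      obtain ⟨a, -, φ, hφ, ha⟩ := tendsto_subseq_of_frequently_bounded
        (Metric.isBounded_ball (x := (0 : ℂ)) (r := B)) (x := fun k => g k z₀)
        (hB.mono fun k hk => by simpa using hk)
      refine ⟨φ, hφ, Or.inl ⟨fun _ => a, ?_⟩⟩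
      rw [Metric.tendstoLocallyUniformlyOn_iff]
      refine fun ε hε z _ => ⟨U, self_mem_nhdsWithin, ?_⟩
      filter_upwards [(hn_top.comp hφ.tendsto_atTop).eventually (h (ε / 2) (by positivity)),
        Metric.tendsto_nhds.mp ha (ε / 2) (by positivity)] with k h1 h2 y hy
      have h3 := h1 z₀ hz₀ y hy
      simp only [← hn, Function.comp_apply] at h2 h3 ⊢
      rw [dist_comm] at h2
      linarith [dist_triangle a (f^[n (φ k)] z₀) (f^[n (φ k)] y)]

/-- A point is not in the Fatou set if every neighbourhood contains points whose orbits escape along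
a sequence of times and points whose orbits are eventually bounded along it. -/
theorem notMem_fatouSet {f : ℂ → ℂ} {N : ℕ → ℕ} {ζ : ℂ}
    (hesc : ∃ᶠ z in 𝓝 ζ, Tendsto (fun k => ‖f^[N k] z‖) atTop atTop)
    (hbdd : ∃ᶠ z in 𝓝 ζ, ∃ B, ∀ᶠ k in atTop, ‖f^[N k] z‖ ≤ B) : ζ ∉ fatouSet f := by
  rintro ⟨V, hV, hζV, hnorm⟩
  have hVn := hV.1.mem_nhds hζV
  obtain ⟨z, hz, hzV⟩ := (hesc.and_eventually hVn).exists
  obtain ⟨x, ⟨B, hB⟩, hxV⟩ := (hbdd.and_eventually hVn).exists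
  obtain ⟨φ, hφ, ⟨h, hh⟩ | h⟩ := hnorm (fun k => f^[N k]) fun k => mem_range_self _
  · have h1 := (hh.tendsto_at hzV).norm
    exact not_tendsto_nhds_of_tendsto_atTop (hz.comp hφ.tendsto_atTop) _ h1
  · obtain ⟨k, hk⟩ := ((h {x} (singleton_subset_iff.mpr hxV) isCompact_singleton B).and
      (hφ.tendsto_atTop.eventually hB)).exists
    exact absurd (hk.1 x rfl) (not_lt.mpr hk.2)

theorem isFatouComponent_of_frontier {f : ℂ → ℂ} {U : Set ℂ} (hU : IsPlaneDomain U)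
    (hsub : U ⊆ fatouSet f) (hfr : ∀ ζ ∈ frontier U, ζ ∉ fatouSet f) : IsFatouComponent f U := by
  obtain ⟨z, hz⟩ := hU.2.nonempty
  refine ⟨z, hsub hz, Subset.antisymm
    (hU.2.isPreconnected.subset_connectedComponentIn hz hsub) ?_⟩
  refine isPreconnected_connectedComponentIn.subset_left_of_subset_union hU.1
    isClosed_closure.isOpen_compl (disjoint_compl_right.mono_left subset_closure) (fun w hw => ?_)
    ⟨z, mem_connectedComponentIn (hsub hz), hz⟩
  by_contra hcon
  rw [mem_union, not_or, notMem_compl_iff] at hcon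
  refine hfr w ?_ (connectedComponentIn_subset _ _ hw)
  rw [hU.1.frontier_eq]
  exact ⟨hcon.2, hcon.1⟩

/-- If `f^[k] z = f^[l] w` with `k < l`, the two orbits agree from then on up to the time shift `l -
k`. A set that all of `U` avoids at time `T` and occupies at time `T + (l - k)` forbids this. -/
theorem eq_of_iterates_inter_nonempty {f : ℂ → ℂ} {U : Set ℂ}
    (h : ∀ a s : ℕ, 0 < s → ∃ T ≥ a, ∃ S : Set ℂ, ∀ z ∈ U, f^[T] z ∉ S ∧ f^[T + s] z ∈ S) (k l : ℕ)
    (hkl : ((f^[k] '' U) ∩ (f^[l] '' U)).Nonempty) : k = l := by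
  wlog hlt : k < l generalizing k l
  · rcases (not_lt.mp hlt).eq_or_lt with h' | h'
    · exact h'.symm
    · exact (this l k (by rwa [inter_comm]) h').symm
  exfalso
  obtain ⟨_, ⟨z, hz, rfl⟩, ⟨w, hw, hwz⟩⟩ := hkl
  obtain ⟨T, hT, S, hS⟩ := h k (l - k) (by omega)
  obtain ⟨i, rfl⟩ := Nat.exists_eq_add_of_le' hT
  apply (hS z hz).1
  have h2 := (hS w hw).2
  rwa [show i + k + (l - k) = i + l by omega, Function.iterate_add_apply, hwz,
    ← Function.iterate_add_apply] at h2

theorem isTranscendentalEntire_of_bounded {f : ℂ → ℂ} (hf : Differentiable ℂ f) {y : ℕ → ℂ}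
    (hy : Tendsto (fun k => ‖y k‖) atTop atTop) {B : ℝ} (hB : ∀ k, ‖f (y k)‖ ≤ B) {a b : ℂ}
    (hab : f a ≠ f b) : IsTranscendentalEntire f := by
  refine ⟨hf, ?_⟩
  rintro ⟨p, hp⟩
  rcases le_or_gt p.degree 0 with h | h
  · rw [Polynomial.eq_C_of_degree_le_zero h] at hp
    exact hab (by simp [hp])
  · have h1 := p.tendsto_norm_atTop h hy
    obtain ⟨k, hk⟩ := (h1.eventually_gt_atTop B).exists
    rw [← hp] at hk
    exact absurd (hB k) (not_le.mpr hk)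

/-! ### Combinatorics of the itinerary. -/

section Itinerary

variable {n m : ℕ → ℕ}

theorem exists_le_succ_of_strictMonoOn (hm : StrictMonoOn m (Ici 1)) (k : ℕ) : ∃ p, k ≤ m (p + 1) := by
  refine ⟨k, ?_⟩
  have : StrictMono fun p => m (p + 1) := fun a b hab => hm (by simp) (by simp) (by omega)
  exact this.le_apply

/-- The index of the excursion whose length is first at least `k`. -/
noncomputable def excursionIndex (hm : StrictMonoOn m (Ici 1)) (k : ℕ) : ℕ :=
  Nat.find (exists_le_succ_of_strictMonoOn hm k)

theorem le_excursionIndex (hm : StrictMonoOn m (Ici 1)) (k : ℕ) : k ≤ m (excursionIndex hm k + 1) :=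
  Nat.find_spec (exists_le_succ_of_strictMonoOn hm k)

theorem excursionIndex_succ_of_lt (hm : StrictMonoOn m (Ici 1)) {k : ℕ}
    (h : k < m (excursionIndex hm k + 1)) : excursionIndex hm (k + 1) = excursionIndex hm k := by
  refine le_antisymm (Nat.find_min' _ h) (Nat.find_min' _ ?_)
  have := le_excursionIndex hm (k + 1)
  omega

theorem excursionIndex_succ_of_eq (hm : StrictMonoOn m (Ici 1)) {k : ℕ}
    (h : m (excursionIndex hm k + 1) = k) :
    excursionIndex hm (k + 1) = excursionIndex hm k + 1 := by
  refine le_antisymm (Nat.find_min' _ ?_) ?_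
  · have := hm (a := excursionIndex hm k + 1) (b := excursionIndex hm k + 1 + 1) (by simp) (by simp)
      (by omega)
    omega
  · by_contra hlt
    have h1 := le_excursionIndex hm (k + 1)
    have h2 := hm.monotoneOn (a := excursionIndex hm (k + 1) + 1) (b := excursionIndex hm k + 1)
      (by simp) (by simp) (by omega)
    omega

theorem excursionIndex_one_le (hm : StrictMonoOn m (Ici 1)) : excursionIndex hm 1 ≤ 1 := by
  refine Nat.find_min' _ ?_
  have := hm (a := 1) (b := 2) (by simp) (by simp) (by omega)
  exact (Nat.zero_le _).trans_lt this

/-- The instructions for the stages of the construction. -/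
noncomputable def stageInstruction (n : ℕ → ℕ) (hm : StrictMonoOn m (Ici 1)) (k : ℕ) : Option ℕ :=
  if k = 0 then
    -- If `m 1 = 0`, then `excursionIndex hm 1 = 1`, and the first two central visits merge into one
    -- of length `n 1 + n 2`.
    some (∑ i ∈ Finset.range (excursionIndex hm 1 + 1), (n i + m i) + n (excursionIndex hm 1 + 1))
  else if m (excursionIndex hm k + 1) = k then some (n (excursionIndex hm k + 2)) else none

/-- At time `N k` exactly `k` steps of the current excursion have been made. When its length is `k`,
the next central visit starts; the following `k + 1` outside steps do not overshoot, because `m` is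
strictly increasing. -/
theorem time_eq (hm : StrictMonoOn m (Ici 1)) {N : ℕ → ℕ} (hN0 : N 0 = 0)
    (hN : ∀ k, N (k + 1) = N k + stageLength k (stageInstruction n hm k) + 1) {k : ℕ} (hk : 1 ≤ k) :
    N k = ∑ i ∈ Finset.range (excursionIndex hm k + 1), (n i + m i) +
      n (excursionIndex hm k + 1) + k := by
  induction k, hk using Nat.le_induction with
  | base => rw [hN, hN0]; simp [stageInstruction, stageLength]
  | succ k hk ih =>
    rw [hN, ih]
    have hk0 : k ≠ 0 := by omega
    rcases (le_excursionIndex hm k).lt_or_eq with h | h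
    · rw [excursionIndex_succ_of_lt hm h]
      simp only [stageInstruction, hk0, if_false, h.ne', stageLength]
      ring
    · rw [excursionIndex_succ_of_eq hm h.symm]
      simp only [stageInstruction, hk0, if_false, h.symm, if_true, stageLength]
      rw [Finset.sum_range_succ _ (excursionIndex hm k + 1), ← h]
      ring

theorem not_exists_of_between {t p : ℕ}
    (h1 : ∑ i ∈ Finset.range (p + 1), (n i + m i) + n (p + 1) < t)
    (h2 : t ≤ ∑ i ∈ Finset.range (p + 2), (n i + m i)) :
    ¬ ∃ p : ℕ, ∑ i ∈ Finset.range (p + 1), (n i + m i) < t ∧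
      t ≤ (∑ i ∈ Finset.range (p + 1), (n i + m i)) + n (p + 1) := by
  rintro ⟨p', h3, h4⟩
  have hmono : Monotone fun j => ∑ i ∈ Finset.range j, (n i + m i) :=
    fun a b hab => Finset.sum_le_sum_of_subset (Finset.range_mono hab)
  rcases lt_trichotomy p p' with h | rfl | h
  · have := hmono (show p + 2 ≤ p' + 1 by omega)
    dsimp only at this
    omega
  · omega
  · have := hmono (show p' + 2 ≤ p + 1 by omega)
    dsimp only at this
    rw [Finset.sum_range_succ _ (p' + 1)] at this
    omega

/-- The stage instructions produce the prescribed itinerary. -/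
theorem stageRegion_iff (hn0 : n 0 = 0) (hm0 : m 0 = 0) (hm : StrictMonoOn m (Ici 1)) {N : ℕ → ℕ}
    (hN0 : N 0 = 0) (hN : ∀ k, N (k + 1) = N k + stageLength k (stageInstruction n hm k) + 1)
    {k j : ℕ} (hj : j ≤ stageLength k (stageInstruction n hm k)) :
    (∃ a, stageInstruction n hm k = some a ∧ j < a) ↔
      ∃ p : ℕ, ∑ i ∈ Finset.range (p + 1), (n i + m i) < N k + 1 + j ∧
        N k + 1 + j ≤ (∑ i ∈ Finset.range (p + 1), (n i + m i)) + n (p + 1) := by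
  rcases Nat.eq_zero_or_pos k with rfl | hk
  · have hσ : stageInstruction n hm 0 = some
      (∑ i ∈ Finset.range (excursionIndex hm 1 + 1), (n i + m i) + n (excursionIndex hm 1 + 1)) := by
      simp [stageInstruction]
    rw [hσ] at hj ⊢
    simp only [stageLength] at hj
    rw [hN0]
    simp only [Option.some.injEq, exists_eq_left']
    have h1 := le_excursionIndex hm 1
    constructor
    · intro h
      rcases Nat.le_one_iff_eq_zero_or_eq_one.mp (excursionIndex_one_le hm) with h0 | h0
      · rw [h0] at h
        refine ⟨0, ?_, by omega⟩
        simp [hn0, hm0]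
      · rw [h0] at h
        by_cases hlt : j < n 1
        · refine ⟨0, ?_, ?_⟩ <;> simp [hn0, hm0]
          omega
        · have hm1 : m 1 = 0 := by
            by_contra hne
            have : excursionIndex hm 1 ≤ 0 := Nat.find_min' _ (Nat.one_le_iff_ne_zero.mpr hne)
            omega
          have e : ∑ i ∈ Finset.range (1 + 1), (n i + m i) = n 1 := by
            simp [Finset.sum_range_succ, hn0, hm0, hm1]
          rw [e] at h
          exact ⟨1, by rw [e]; omega, by rw [e]; omega⟩
    · intro h
      by_contra hlt
      refine not_exists_of_between (p := excursionIndex hm 1) (by omega) ?_ h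
      rw [Finset.sum_range_succ _ (excursionIndex hm 1 + 1)]
      omega
  · have hk0 : k ≠ 0 := by omega
    rw [time_eq hm hN0 hN hk]
    rcases (le_excursionIndex hm k).lt_or_eq with h | h
    · have hσ : stageInstruction n hm k = none := by simp [stageInstruction, hk0, h.ne']
      rw [hσ] at hj ⊢
      simp only [stageLength] at hj
      simp only [reduceCtorEq, false_and, exists_false, false_iff]
      refine not_exists_of_between (p := excursionIndex hm k) (by omega) ?_
      rw [Finset.sum_range_succ _ (excursionIndex hm k + 1)]
      omega
    · have hσ : stageInstruction n hm k = some (n (excursionIndex hm k + 2)) := by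
        simp [stageInstruction, hk0, h.symm]
      rw [hσ] at hj ⊢
      simp only [stageLength] at hj
      simp only [Option.some.injEq, exists_eq_left']
      have e : ∑ i ∈ Finset.range (excursionIndex hm k + 1), (n i + m i) +
          n (excursionIndex hm k + 1) + k =
          ∑ i ∈ Finset.range (excursionIndex hm k + 1 + 1), (n i + m i) := by
        rw [Finset.sum_range_succ _ (excursionIndex hm k + 1)]
        omega
      rw [e]
      constructor
      · intro hlt
        exact ⟨excursionIndex hm k + 1, by omega, by
          rw [show excursionIndex hm k + 1 + 1 = excursionIndex hm k + 2 by ring]; omega⟩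
      · intro hex
        by_contra hlt
        have h3 := hm (a := excursionIndex hm k + 1) (b := excursionIndex hm k + 2)
          (by simp) (by simp) (by omega)
        refine not_exists_of_between (p := excursionIndex hm k + 1) (by
          rw [show excursionIndex hm k + 1 + 1 = excursionIndex hm k + 2 by ring] at *; omega) ?_ hex
        rw [Finset.sum_range_succ _ (excursionIndex hm k + 1 + 1)]
        rw [show excursionIndex hm k + 1 + 1 = excursionIndex hm k + 2 by ring] at *
        omega

/-- Every positive time belongs to exactly one stage. -/
theorem exists_stage_of_pos {N : ℕ → ℕ} (hN0 : N 0 = 0) {L : ℕ → ℕ}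
    (hN : ∀ k, N (k + 1) = N k + L k + 1) {t : ℕ} (ht : 1 ≤ t) : ∃ k j, j ≤ L k ∧ t = N k + 1 + j := by
  induction t, ht using Nat.le_induction with
  | base => exact ⟨0, 0, by omega, by omega⟩
  | succ t _ ih =>
    obtain ⟨k, j, hj, rfl⟩ := ih
    rcases hj.lt_or_eq with h | h
    · exact ⟨k, j + 1, h, by omega⟩
    · exact ⟨k + 1, 0, by omega, by have := hN k; omega⟩

/-- The orbit returns to the central region at infinitely many stages. -/
theorem exists_return_stage (hm : StrictMonoOn m (Ici 1)) (b : ℕ) :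
    ∃ k ≥ b, ∃ a, stageInstruction n hm k = some a := by
  have hb : b + 1 ≤ m (b + 2) := by
    have : StrictMono fun p => m (p + 1) := fun a b hab => hm (by simp) (by simp) (by omega)
    exact this.le_apply (x := b + 1)
  refine ⟨m (b + 2), by omega, n (b + 3), ?_⟩
  have hidx : excursionIndex hm (m (b + 2)) = b + 1 := by
    refine le_antisymm (Nat.find_min' _ le_rfl) ?_
    by_contra hlt
    have h1 := le_excursionIndex hm (m (b + 2))
    have h2 := hm (a := excursionIndex hm (m (b + 2)) + 1) (b := b + 2) (by simp) (by simp) (by omega)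
    omega
  rw [stageInstruction, if_neg (by omega), hidx, if_pos rfl]

end Itinerary

/-! ### The trap about `1`, and the conclusion. -/

theorem iterate_translate (f : ℂ → ℂ) (a z : ℂ) (i : ℕ) :
    (fun z => f (z + a) - a)^[i] z = f^[i] (z + a) - a := by
  induction i with
  | zero => simp
  | succ i ih => rw [Function.iterate_succ_apply', Function.iterate_succ_apply', ih]; simp

/-- Superattraction at `1` gives `1/16 + 1/10 < 1/4`. -/
theorem norm_sub_one_lt_of_near_basePoly {f : ℂ → ℂ} {z : ℂ} (h : ‖f z - basePoly z‖ ≤ 1 / 10)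
    (hz : ‖z - 1‖ < 1 / 4) : ‖f z - 1‖ < 1 / 4 := by
  have e : f z - 1 = (f z - basePoly z) - (z - 1) ^ 2 := by unfold basePoly; ring
  rw [e]
  refine (norm_sub_le _ _).trans_lt ?_
  rw [norm_pow]
  nlinarith [norm_nonneg (z - 1)]

theorem norm_iterate_sub_one_lt {f : ℂ → ℂ} {ρ : ℝ} (hρ : 10 ≤ ρ)
    (hn : ∀ z, ‖z‖ ≤ ρ → ‖f z - basePoly z‖ ≤ 1 / 10) {z : ℂ} {T : ℕ} (hT : ‖f^[T] z - 1‖ < 1 / 4)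
    {t : ℕ} (ht : T ≤ t) : ‖f^[t] z - 1‖ < 1 / 4 := by
  induction t, ht using Nat.le_induction with
  | base => exact hT
  | succ t _ ih =>
    rw [Function.iterate_succ_apply']
    refine norm_sub_one_lt_of_near_basePoly (hn _ ?_) ih
    have := norm_sub_norm_le (f^[t] z) 1
    rw [norm_one] at this
    linarith

theorem IsFullCompact.image_homeomorph {K : Set ℂ} (hK : IsFullCompact K) (e : ℂ ≃ₜ ℂ) :
    IsFullCompact (e '' K) := by
  refine ⟨hK.1.image e.continuous, ?_⟩
  rw [← image_compl_eq e.bijective]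
  exact hK.2.image e e.continuous.continuousOn

theorem IsFullCompact.nonempty_frontier {K : Set ℂ} (hK : IsFullCompact K) (hne : K.Nonempty) :
    (frontier K).Nonempty := by
  refine nonempty_frontier_iff.mpr ⟨hne, fun h => ?_⟩
  have := hK.2.nonempty
  rw [h, compl_univ] at this
  exact this.ne_empty rfl

/-- Each point of a dense sequence is repeated infinitely often, since `x k` approximates `ζ k` well
only for large `k`. -/
theorem exists_recurrent_dense_seq {E : Set ℂ} (hE : E.Nonempty) :
    ∃ ζ : ℕ → ℂ, (∀ k, ζ k ∈ E) ∧ ∀ w ∈ E, ∀ ε > 0, ∀ b : ℕ, ∃ k ≥ b, dist w (ζ k) < ε := by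
  have : Nonempty E := hE.to_subtype
  refine ⟨fun k => TopologicalSpace.denseSeq E k.unpair.1, fun k => Subtype.coe_prop _,
    fun w hw ε hε b => ?_⟩
  obtain ⟨i, hi⟩ := (TopologicalSpace.denseRange_denseSeq E).exists_dist_lt ⟨w, hw⟩ hε
  exact ⟨Nat.pair i b, Nat.right_le_pair i b, by dsimp only; rw [Nat.unpair_pair]; exact hi⟩

theorem theorem1p1 (U : Set ℂ) (hU : IsRegularDomain U) (hK : IsFullCompact (closure U))
    (n m : ℕ → ℕ) (hn0 : n 0 = 0) (hm0 : m 0 = 0) (hm : StrictMonoOn m (Set.Ici 1)) :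
    ∃ D : Set ℂ, IsPlaneDomain D ∧ Bornology.IsBounded D ∧
      ∃ f : ℂ → ℂ, IsTranscendentalEntire f ∧ IsWanderingDomain f U ∧
        ∀ k : ℕ, 1 ≤ k →
          (f^[k] '' U ⊆ D ∨ f^[k] '' U ⊆ (closure D)ᶜ) ∧
          (f^[k] '' U ⊆ D ↔
            ∃ p : ℕ, ∑ i ∈ Finset.range (p + 1), (n i + m i) < k ∧
              k ≤ (∑ i ∈ Finset.range (p + 1), (n i + m i)) + n (p + 1)) := by
  obtain ⟨hUd, hreg⟩ := hU
  obtain ⟨u₀, hu₀⟩ := hUd.2.nonempty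
  -- Regularity enters here: points outside `closure U` then accumulate at every frontier point of
  -- `U`.
  have hfrU : frontier U = frontier (closure U) := by
    rw [hUd.1.frontier_eq, isClosed_closure.frontier_eq, hreg]
  obtain ⟨B, hB0, hB⟩ := hK.1.isBounded.subset_ball_lt 0 0
  set ρ : ℝ := 5 * B + 10 with hρdef
  have hρ : 10 ≤ ρ := by linarith
  set a : ℂ := ((2 * ρ : ℝ) : ℂ)
  let e : ℂ ≃ₜ ℂ := Homeomorph.addRight a
  have hK' : IsFullCompact (e '' closure U) := hK.image_homeomorph e
  have hKρ : e '' closure U ⊆ Metric.ball a (ρ / 5) := by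
    rintro _ ⟨z, hz, rfl⟩
    have := hB hz
    rw [mem_ball_zero_iff] at this
    rw [mem_ball_iff_norm]
    change ‖z + a - a‖ < _
    rw [add_sub_cancel_right]
    linarith
  obtain ⟨ζ, hζ, hζd⟩ := exists_recurrent_dense_seq (hK.nonempty_frontier ⟨u₀, subset_closure hu₀⟩)
  obtain ⟨f, N, R, x, hf, hfn, hN0, hN, hRk, hρR, hx, hbeh⟩ :=
    exists_entire_stageBehaviour hK' hρ hKρ (stageInstruction n hm) (ζ := fun k => e (ζ k))
      (fun k => by rw [← e.image_frontier]; exact mem_image_of_mem _ (hζ k))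
  have hmemK : ∀ z ∈ U, z + a ∈ e '' closure U := fun z hz => ⟨z, subset_closure hz, rfl⟩
  let F : ℂ → ℂ := fun z => f (z + a) - a
  have hFi : ∀ i z, F^[i] z = f^[i] (z + a) - a := fun i z => iterate_translate f a z i
  have hNmono : StrictMono N := strictMono_nat_of_lt_succ fun k => by rw [hN]; omega
  have hRtop : Tendsto R atTop atTop := tendsto_atTop_mono hRk tendsto_natCast_atTop_atTop
  have hRtop' : Tendsto (fun k => R k - ‖a‖) atTop atTop :=
    tendsto_atTop_add_const_right _ _ hRtop
  have hreturn : ∀ b, ∃ k ≥ b, k ≤ stageLength k (stageInstruction n hm k) := by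
    intro b
    obtain ⟨k, hk, c, hc⟩ := exists_return_stage (n := n) hm b
    exact ⟨k, hk, by rw [hc]; simp [stageLength]⟩
  have hsmall : ∀ ε > 0, ∀ᶠ t in atTop, ∀ z ∈ U, ∀ w ∈ U, dist (F^[t] z) (F^[t] w) ≤ ε := by
    intro ε hε
    obtain ⟨k₀, hk₀⟩ := exists_nat_one_div_lt hε
    filter_upwards [eventually_gt_atTop (N k₀)] with t ht z hz w hw
    obtain ⟨k, j, hj, rfl⟩ := exists_stage_of_pos hN0 hN (show 1 ≤ t by omega)
    have hkk : k₀ ≤ k := by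
      by_contra hlt
      have h1 := hNmono.monotone (show k + 1 ≤ k₀ by omega)
      have h2 := hN k
      omega
    rw [hFi, hFi, dist_sub_right]
    refine ((hbeh k).dist_le j hj _ (hmemK z hz) _ (hmemK w hw)).trans (le_trans ?_ hk₀.le)
    gcongr
  have hesc : ∀ z ∈ U, Tendsto (fun k => ‖F^[N k] z‖) atTop atTop := by
    refine fun z hz => tendsto_atTop_mono (fun k => ?_) hRtop'
    rw [hFi]
    linarith [(hbeh k).outside _ (hmemK z hz), norm_sub_norm_le (f^[N k] (z + a)) a]
  have hxbdd : ∀ k, ∃ C, ∀ᶠ l in atTop, ‖F^[N l] (x k - a)‖ ≤ C := by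
    refine fun k => ⟨2 + ‖a‖, ?_⟩
    filter_upwards [eventually_ge_atTop (k + 1)] with l hl
    have h1 : N k + 1 ≤ N l := by
      have := hNmono (show k < l by omega)
      omega
    have h2 := norm_iterate_sub_one_lt hρ hfn (hbeh k).point_trapped h1
    rw [hFi, sub_add_cancel]
    have h3 := norm_sub_norm_le (f^[N l] (x k)) 1
    rw [norm_one] at h3
    linarith [norm_sub_le (f^[N l] (x k)) a]
  have hxdense : ∀ w ∈ frontier U, ∀ ε > 0, ∃ k, dist (x k - a) w < ε := by
    intro w hw ε hε
    rw [hfrU] at hw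
    obtain ⟨b, hb⟩ := exists_nat_one_div_lt (show 0 < ε / 2 by positivity)
    obtain ⟨k, hk, hkd⟩ := hζd w hw (ε / 2) (by positivity) b
    refine ⟨k, ?_⟩
    have h1 : dist (x k - a) (ζ k) < 1 / (k + 1) := by
      have h2 : dist (x k) (ζ k + a) < 1 / (k + 1) := (hx k).2
      rwa [dist_eq_norm, ← sub_sub, sub_right_comm, ← dist_eq_norm] at h2
    have h2 : (1 : ℝ) / (k + 1) ≤ 1 / (b + 1) := by gcongr
    rw [dist_comm] at hkd
    linarith [dist_triangle (x k - a) (ζ k) w]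
  have hcomp : IsFatouComponent F U := by
    refine isFatouComponent_of_frontier hUd
      (fun z hz => ⟨U, hUd, hz, isNormalFamilyOn_iterates hsmall⟩)
      fun w hw => notMem_fatouSet (N := N) ?_ ?_
    · exact (mem_closure_iff_frequently.mp (frontier_subset_closure hw)).mono hesc
    · refine Metric.nhds_basis_ball.frequently_iff.mpr fun ε hε => ?_
      obtain ⟨k, hk⟩ := hxdense w hw ε hε
      exact ⟨x k - a, hk, hxbdd k⟩
  have hdisj : ∀ b s : ℕ, 0 < s → ∃ T ≥ b, ∃ S : Set ℂ, ∀ z ∈ U, F^[T] z ∉ S ∧ F^[T + s] z ∈ S := by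
    intro b s hs
    obtain ⟨k, hk, hkL⟩ := hreturn (max b s)
    -- At a return stage with `k ≥ s`, the set is outside the disc of radius `R k` at time `N k` and
    -- inside it at time `N k + s`.
    refine ⟨N k, ((le_max_left _ _).trans hk).trans hNmono.le_apply, {z | ‖z + a‖ < R k},
      fun z hz => ?_⟩
    simp only [mem_ofPred_eq, hFi, sub_add_cancel, not_lt]
    refine ⟨((hbeh k).outside _ (hmemK z hz)).le, ?_⟩
    have h1 : s ≤ k := (le_max_right _ _).trans hk
    have := (hbeh k).inside (s - 1) (by omega) _ (hmemK z hz)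
    rwa [show N k + 1 + (s - 1) = N k + s by omega] at this
  have htrans : IsTranscendentalEntire F := by
    -- The orbit points of `x k` at time `N k` tend to infinity, yet their images lie in the
    -- translated trap.
    refine isTranscendentalEntire_of_bounded (hf.comp (by fun_prop) |>.sub_const a)
      (y := fun k => F^[N k] (x k - a)) (B := 2 + ‖a‖) (tendsto_atTop_mono (fun k => ?_) hRtop')
      (fun k => ?_) (a := -a) (b := 1 - a) ?_
    · rw [hFi, sub_add_cancel]
      linarith [(hbeh k).point_outside, norm_sub_norm_le (f^[N k] (x k)) a]
    · rw [← Function.iterate_succ_apply' F, hFi, sub_add_cancel]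
      have h2 := (hbeh k).point_trapped
      have h3 := norm_sub_norm_le (f^[N k + 1] (x k)) 1
      rw [norm_one] at h3
      linarith [norm_sub_le (f^[N k + 1] (x k)) a]
    · intro h
      have h0 := hfn 0 (by simp; linarith)
      have h1 := norm_sub_one_lt_of_near_basePoly (hfn 1 (by simp; linarith)) (by simp)
      have h2 : f 0 = f 1 := by simpa [F] using h
      simp only [basePoly, mul_zero, ne_eq, OfNat.ofNat_ne_zero, not_false_eq_true, zero_pow,
        sub_zero] at h0
      rw [h2] at h0
      have h3 := norm_sub_le (f 1) (f 1 - 1)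
      rw [sub_sub_cancel, norm_one] at h3
      linarith
  have hD : ∀ z, z ∈ Metric.ball (-a) ρ ↔ ‖z + a‖ < ρ := fun z => by
    rw [mem_ball_iff_norm, sub_neg_eq_add]
  have hDc : ∀ z, z ∈ (closure (Metric.ball (-a) ρ))ᶜ ↔ ρ < ‖z + a‖ := fun z => by
    rw [closure_ball _ (by linarith), mem_compl_iff, mem_closedBall_iff_norm, sub_neg_eq_add, not_le]
  refine ⟨Metric.ball (-a) ρ, ⟨Metric.isOpen_ball, ⟨-a, Metric.mem_ball_self (by linarith)⟩,
    (convex_ball _ _).isPreconnected⟩, Metric.isBounded_ball, F, htrans,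
    ⟨hcomp, eq_of_iterates_inter_nonempty hdisj⟩, fun t ht => ?_⟩
  obtain ⟨k, j, hj, rfl⟩ := exists_stage_of_pos hN0 hN ht
  have hregion := fun z hz => (hbeh k).region j hj _ (hmemK z hz)
  rw [← stageRegion_iff hn0 hm0 hm hN0 hN hj]
  by_cases hin : ∃ c, stageInstruction n hm k = some c ∧ j < c
  · simp only [stageRegion, hin, if_true, mem_ofPred_eq] at hregion
    have hsub : F^[N k + 1 + j] '' U ⊆ Metric.ball (-a) ρ := by
      rintro _ ⟨z, hz, rfl⟩
      rw [hD, hFi, sub_add_cancel]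
      exact hregion z hz
    exact ⟨Or.inl hsub, iff_of_true hsub hin⟩
  · simp only [stageRegion, hin, if_false, mem_ofPred_eq] at hregion
    refine ⟨Or.inr ?_, iff_of_false (fun hsub => ?_) hin⟩
    · rintro _ ⟨z, hz, rfl⟩
      rw [hDc, hFi, sub_add_cancel]
      exact hregion z hz
    · have h1 := hsub (mem_image_of_mem _ hu₀)
      rw [hD, hFi, sub_add_cancel] at h1
      exact absurd h1 (hregion u₀ hu₀).not_gt
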